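/- Let $K$ be a field and let $H$ be a numerical semigroup, i.e. a submonoid of $(\mathbb N,+)$ with $\mathbb N\setminus H$ finite. Let $R=K[[H]]\subseteq K[[t]]$ be the ring of formal power series all of whose exponents lie in $H$; it is a one-dimensional Cohen–Macaulay local domain with a canonical module $\omega_R$. Let $\overline R$ be the integral closure of $R$ in its total ring of fractions $\mathrm Q(R)$, and let $R:\overline R=\{x\in \mathrm Q(R): x\overline R\subseteq R\}$. Let $\mathrm{tr}_R(\omega_R)=\sum_{f\in \mathrm{Hom}_R(\omega_R,R)}\mathrm{Im} f$ be the trace of $\omega_R$. Let $n(H)=|\{h\in H: h<\mathrm F(H)\}|$, where $\mathrm F(H)$ is the largest integer in $\mathbb N\setminus H$ (and $n(H)=0$ if $H=\mathbb N$). Let $$bg(R)=\inf\{\ell_S(R/S) : S\subseteq R \text{ is a subring that is a Gorenstein ring and } S\subseteq R \text{ is birational}\},$$ where $\ell$ denotes length and $S\subseteq R$ is birational if $\mathrm Q(S)=\mathrm Q(R)$ and $R$ is finitely generated as an $S$-module. If $R$ is far-flung Gorenstein, i.e. $\mathrm{tr}_R(\omega_R)=R:\overline R$, then $$bg(R)=n(H)=\ell_R(R/\mathrm{tr}_R(\omega_R)).$$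 -/

import Mathlib

open CategoryTheory

universe u

namespace FarFlung

section Semigroups

/-- The Frobenius number of a numerical semigroup: the largest gap. For `H = ℕ` there is no gap,
and the value is `0`; it is then still true that no element of `H` is smaller. -/
noncomputable def frobeniusNumber (H : AddSubmonoid ℕ) : ℕ :=
  sSup {a : ℕ | a ∉ H}

/-- The number `n(H)` of elements of `H` below the Frobenius number. -/
noncomputable def numNonGaps (H : AddSubmonoid ℕ) : ℕ :=
  {h : ℕ | h ∈ H ∧ h < frobeniusNumber H}.ncard

/-- The ring `K[[H]]`: the formal power series over `K` whose exponents all lie in `H`. -/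
def semigroupRing (K : Type u) [Field K] (H : AddSubmonoid ℕ) :
    Subalgebra K (PowerSeries K) where
  carrier := {f | ∀ n, n ∉ H → PowerSeries.coeff n f = 0}
  mul_mem' := by
    intro f g hf hg n hn
    rw [PowerSeries.coeff_mul]
    refine Finset.sum_eq_zero fun p hp => ?_
    rw [Finset.HasAntidiagonal.mem_antidiagonal] at hp
    by_cases h1 : p.1 ∈ H
    · have h2 : p.2 ∉ H := fun h2 => hn (hp ▸ H.add_mem h1 h2)
      rw [hg _ h2, mul_zero]
    · rw [hf _ h1, zero_mul]
  add_mem' := by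
    intro f g hf hg n hn
    rw [map_add, hf n hn, hg n hn, add_zero]
  algebraMap_mem' := by
    intro r n hn
    have h0 : n ≠ 0 := fun h => hn (h ▸ H.zero_mem)
    rw [PowerSeries.algebraMap_apply, PowerSeries.coeff_C, if_neg h0]

theorem inv_mem_semigroupRing {K : Type u} [Field K] {H : AddSubmonoid ℕ} {f : PowerSeries K}
    (hf : f ∈ semigroupRing K H) : f⁻¹ ∈ semigroupRing K H := by
  intro n
  induction n using Nat.strong_induction_on with
  | _ n ih =>
    intro hn
    have h0 : n ≠ 0 := fun h => hn (h ▸ H.zero_mem)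
    rw [PowerSeries.coeff_inv, if_neg h0]
    refine mul_eq_zero_of_right _ (Finset.sum_eq_zero fun p hp => ?_)
    rw [Finset.HasAntidiagonal.mem_antidiagonal] at hp
    split_ifs with hlt
    · by_cases h1 : p.1 ∈ H
      · have h2 : p.2 ∉ H := fun h2 => hn (hp ▸ H.add_mem h1 h2)
        rw [ih _ hlt h2, mul_zero]
      · rw [hf _ h1, zero_mul]
    · rfl

theorem isUnit_of_constantCoeff_ne_zero {K : Type u} [Field K] {H : AddSubmonoid ℕ}
    (f : semigroupRing K H) (hf : PowerSeries.constantCoeff (f : PowerSeries K) ≠ 0) :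
    IsUnit f :=
  IsUnit.of_mul_eq_one ⟨(f : PowerSeries K)⁻¹, inv_mem_semigroupRing f.2⟩
    (Subtype.ext (PowerSeries.mul_inv_cancel _ hf))

instance (K : Type u) [Field K] (H : AddSubmonoid ℕ) : IsLocalRing (semigroupRing K H) := by
  refine IsLocalRing.of_isUnit_or_isUnit_one_sub_self fun f => ?_
  by_cases hf : PowerSeries.constantCoeff (f : PowerSeries K) = 0
  · right
    refine isUnit_of_constantCoeff_ne_zero _ ?_
    simp [hf]
  · exact Or.inl (isUnit_of_constantCoeff_ne_zero f hf)

end Semigroups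

section Rings

/-- A commutative ring is Gorenstein if it is Noetherian and its localization at each maximal ideal
has finite injective dimension as a module over itself. -/
structure IsGorenstein (A : Type u) [CommRing A] : Prop where
  isNoetherianRing : IsNoetherianRing A
  finite_injectiveDimension : ∀ (m : Ideal A) [m.IsMaximal], ∃ n : ℕ,
    HasInjectiveDimensionLT
      (ModuleCat.of (Localization.AtPrime m) (Localization.AtPrime m)) n

/-- For a subring `S` of `R`, the extension `S ⊆ R` is birational if `Q(S) = Q(R)` (the total ring
of fractions of `R` is, via the inclusion, one of `S`) and `R` is a finite `S`-module. -/
structure IsBirational {R : Type u} [CommRing R] (S : Subring R) : Prop where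
  isFractionRing : IsFractionRing S (FractionRing R)
  finite : Module.Finite S R

/-- The birational Gorenstein colength `bg(R)`: the infimum of the lengths `ℓ_S(R / S)` over the
Gorenstein subrings `S` of `R` for which `S ⊆ R` is birational (`⊤` if there is none). -/
noncomputable def bg (R : Type u) [CommRing R] : ℕ∞ :=
  sInf {l : ℕ∞ | ∃ S : Subring R, IsGorenstein S ∧ IsBirational S ∧
    l = Module.length S (R ⧸ LinearMap.range (Algebra.linearMap S R))}

/-- Canonical modules of a Cohen–Macaulay local ring `R` with residue field `k`: the finitely
generated modules `ω` such that `Ext^i(k, ω)` is one-dimensional over `k` for `i = dim R` and zero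
for `i ≠ dim R`; in other words the maximal Cohen–Macaulay modules of type one and of finite
injective dimension. -/
structure IsCanonicalModule (R : Type u) [CommRing R] [IsLocalRing R]
    (ω : Type u) [AddCommGroup ω] [Module R ω] : Prop where
  finite : Module.Finite R ω
  length_ext_eq_one : ∀ i : ℕ, (i : WithBot ℕ∞) = ringKrullDim R →
    Module.length R (Abelian.Ext
      (ModuleCat.of R (IsLocalRing.ResidueField R)) (ModuleCat.of R ω) i) = 1
  length_ext_eq_zero : ∀ i : ℕ, (i : WithBot ℕ∞) ≠ ringKrullDim R →
    Module.length R (Abelian.Ext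
      (ModuleCat.of R (IsLocalRing.ResidueField R)) (ModuleCat.of R ω) i) = 0

/-- The trace of a module `M`: the sum of the images of all linear maps `M → R`. -/
def trace (R : Type u) [CommRing R] (M : Type u) [AddCommGroup M] [Module R M] : Ideal R :=
  ⨆ f : M →ₗ[R] R, LinearMap.range f

/-- The colon `R : R̄` in the total ring of fractions `Q(R)`, where `R̄` is the integral closure of
`R` in `Q(R)`. -/
noncomputable def conductorColon (R : Type u) [CommRing R] : Submodule R (FractionRing R) :=
  1 / Subalgebra.toSubmodule (integralClosure R (FractionRing R))

/-- With canonical module `ω`, the ring `R` is far-flung Gorenstein if `tr(ω) = R : R̄`, as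
submodules of `Q(R)`. -/
def IsFarFlungGorenstein (R : Type u) [CommRing R]
    (ω : Type u) [AddCommGroup ω] [Module R ω] : Prop :=
  Submodule.map (Algebra.linearMap R (FractionRing R)) (trace R ω) = conductorColon R

end Rings

end FarFlung

/-! Write `R = K[[H]]`, `Q = K((t))` and `F` for the Frobenius number. The integral closure `R̄` is
`K[[t]]`, so (for `H ≠ ℕ`) `R : R̄` consists of the series of order at least `F + 1`. Far-flungness
says that this is the trace, and filtering `R` by order gives `ℓ(R / tr ω) = n(H)`
(`length_quotient_trace`).

Upper bound, valid for every `H`: if `H ≠ ℕ`, then `{0} ∪ {n > F}` with `2F + 1` removed is a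
symmetric semigroup `H' ⊆ H`, and `H \ H'` is the set of elements of `H` below `F` with `0` traded
for `2F + 1`. The ring `K[[H']]` is Gorenstein because `K((t)) / K[[H']]` is injective, by the
pairing that sends `(x, z)` to the coefficient of `xz` at the Frobenius number
(`baer_laurentSeries_quotient`).

Lower bound: let `S ⊆ R` be Gorenstein and birational. Then `S` is a one-dimensional local domain,
finite injective dimension makes `Q / S` injective, and `J ↦ S : J` is a duality of fractional
ideals (`one_div_one_div`). Put `a = tr ω = R : R̄`. The vanishing of `Ext²(k, ω)` gives `S : R ⊆ a`
(`mem_trace_of_conductor`). Dualizing, `S : a ⊆ S : (S : R) = R`; since `S : a` is stable under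
`R̄`, even `S : a ⊆ a`. Hence `S : (S ∩ a) = S + (S : a) ⊆ S + a`, and duality turns chains between
`S ∩ a` and `S` into chains between `S` and `S + a`. So `ℓ(S / (S ∩ a)) ≤ ℓ((S + a) / S)`, and
adding `ℓ(R / (S + a))` yields `ℓ_S(R / a) ≤ ℓ_S(R / S)` (`length_quotient_colon_le`). Passing from
`ℓ_S` to `ℓ_R` only decreases the left side. -/

namespace FarFlung

/-! ### Vanishing of Ext along short exact sequences -/

section ExtSequences

open Abelian

variable {A : Type u} [CommRing A]

/-- The vanishing of `Ext^i(N, W)` for modules over a commutative ring. -/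
abbrev ExtVanishes (A : Type u) [CommRing A] (N W : Type u) [AddCommGroup N] [Module A N]
    [AddCommGroup W] [Module A W] (i : ℕ) : Prop :=
  ∀ e : Ext (ModuleCat.of A N) (ModuleCat.of A W) i, e = 0

variable {N₁ N₂ N₃ W : Type u} [AddCommGroup N₁] [Module A N₁] [AddCommGroup N₂] [Module A N₂]
  [AddCommGroup N₃] [Module A N₃] [AddCommGroup W] [Module A W]
  {f : N₁ →ₗ[A] N₂} {g : N₂ →ₗ[A] N₃}

theorem shortExact_of_exact (hf : Function.Injective f) (hg : Function.Surjective g)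
    (h : Function.Exact f g) :
    (ModuleCat.shortComplexOfCompEqZero f g h.linearMap_comp_eq_zero).ShortExact :=
  ModuleCat.shortComplex_shortExact _ h hf hg

theorem ExtVanishes.middle (hf : Function.Injective f) (hg : Function.Surjective g)
    (h : Function.Exact f g) {i : ℕ} (h₁ : ExtVanishes A N₁ W i) (h₃ : ExtVanishes A N₃ W i) :
    ExtVanishes A N₂ W i := by
  intro e
  obtain ⟨y, rfl⟩ := Ext.contravariant_sequence_exact₂ (shortExact_of_exact hf hg h) _ e (h₁ _)
  rw [h₃ y, Ext.comp_zero]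

theorem ExtVanishes.left (hf : Function.Injective f) (hg : Function.Surjective g)
    (h : Function.Exact f g) {i : ℕ} (h₂ : ExtVanishes A N₂ W i)
    (h₃ : ExtVanishes A N₃ W (i + 1)) : ExtVanishes A N₁ W i := by
  intro e
  obtain ⟨y, rfl⟩ := Ext.contravariant_sequence_exact₁ (shortExact_of_exact hf hg h) _ e
    (Nat.add_comm 1 i) (h₃ _)
  rw [h₂ y, Ext.comp_zero]

theorem ExtVanishes.right (hf : Function.Injective f) (hg : Function.Surjective g)
    (h : Function.Exact f g) {i : ℕ} (h₁ : ExtVanishes A N₁ W i)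
    (h₂ : ExtVanishes A N₂ W (i + 1)) : ExtVanishes A N₃ W (i + 1) := by
  intro e
  obtain ⟨y, rfl⟩ := Ext.contravariant_sequence_exact₃ (shortExact_of_exact hf hg h) _ e
    (h₂ _) (Nat.add_comm 1 i)
  rw [h₁ y, Ext.comp_zero]

theorem ExtVanishes.target_right (hf : Function.Injective f) (hg : Function.Surjective g)
    (h : Function.Exact f g) {i : ℕ} (h₂ : ExtVanishes A W N₂ i)
    (h₁ : ExtVanishes A W N₁ (i + 1)) : ExtVanishes A W N₃ i := by
  intro e
  obtain ⟨y, rfl⟩ := Ext.covariant_sequence_exact₃ _ (shortExact_of_exact hf hg h) e rfl (h₁ _)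
  rw [h₂ y, Ext.zero_comp]

theorem ExtVanishes.exists_extension (hf : Function.Injective f) (hg : Function.Surjective g)
    (h : Function.Exact f g) (h₃ : ExtVanishes A N₃ W 1) (φ : N₁ →ₗ[A] W) :
    ∃ ψ : N₂ →ₗ[A] W, ψ ∘ₗ f = φ := by
  obtain ⟨y, hy⟩ := Ext.contravariant_sequence_exact₁ (shortExact_of_exact hf hg h) _
    (Ext.mk₀ (ModuleCat.ofHom φ)) (zero_add 1) (h₃ _)
  obtain ⟨y, rfl⟩ := Ext.homEquiv₀.symm.surjective y
  have := Ext.homEquiv₀.symm.injective (a₁ := ModuleCat.ofHom f ≫ y) (a₂ := ModuleCat.ofHom φ)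
    (by simpa using hy)
  exact ⟨y.hom, by simpa using congrArg ModuleCat.Hom.hom this⟩

theorem ExtVanishes.exists_lift (hf : Function.Injective f) (hg : Function.Surjective g)
    (h : Function.Exact f g) (h₁ : ExtVanishes A W N₁ 1) (φ : W →ₗ[A] N₃) :
    ∃ ψ : W →ₗ[A] N₂, g ∘ₗ ψ = φ := by
  obtain ⟨y, hy⟩ := Ext.covariant_sequence_exact₃ _ (shortExact_of_exact hf hg h)
    (Ext.mk₀ (ModuleCat.ofHom φ)) (zero_add 1) (h₁ _)
  obtain ⟨y, rfl⟩ := Ext.homEquiv₀.symm.surjective y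
  have := Ext.homEquiv₀.symm.injective (a₁ := y ≫ ModuleCat.ofHom g) (a₂ := ModuleCat.ofHom φ)
    (by simpa using hy)
  exact ⟨y.hom, by simpa using congrArg ModuleCat.Hom.hom this⟩

theorem ExtVanishes.of_projective [Module.Projective A N₁] (i : ℕ) :
    ExtVanishes A N₁ W (i + 1) := fun e => e.eq_zero_of_projective

theorem ExtVanishes.of_baer (hW : Module.Baer A W) (i : ℕ) : ExtVanishes A N₁ W (i + 1) := by
  have := hW.injective
  have : Injective (ModuleCat.of A W) := Module.injective_object_of_injective_module A W
  exact fun e => e.eq_zero_of_injective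

theorem ExtVanishes.of_subsingleton [Subsingleton N₁] (i : ℕ) : ExtVanishes A N₁ W i := by
  intro e
  have h : Limits.IsZero (ModuleCat.of A N₁) := ModuleCat.isZero_of_subsingleton _
  rw [← e.mk₀_id_comp, h.eq_zero_of_src (𝟙 _), Ext.mk₀_zero, Ext.zero_comp]

theorem ExtVanishes.congr (e : N₁ ≃ₗ[A] N₂) {i : ℕ} (h : ExtVanishes A N₁ W i) :
    ExtVanishes A N₂ W i :=
  ExtVanishes.middle (f := e.toLinearMap) (g := (0 : N₂ →ₗ[A] PUnit.{u + 1})) e.injective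
    (fun _ => ⟨0, rfl⟩) (fun y => ⟨fun _ => e.surjective y, fun _ => rfl⟩) h
    (ExtVanishes.of_subsingleton i)

/-- Induction along a composition series, all of whose factors are the residue field. -/
theorem ExtVanishes.of_isFiniteLength [IsLocalRing A] {i : ℕ}
    (h : ExtVanishes A (IsLocalRing.ResidueField A) W i) {N : Type u} [AddCommGroup N]
    [Module A N] (hN : IsFiniteLength A N) : ExtVanishes A N W i := by
  induction hN with
  | of_subsingleton => exact ExtVanishes.of_subsingleton i
  | @of_simple_quotient M _ _ N _ _ ih =>
    obtain ⟨m, hm, ⟨e⟩⟩ := isSimpleModule_iff_quot_maximal.mp ‹IsSimpleModule A (M ⧸ N)›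
    obtain rfl := IsLocalRing.eq_maximalIdeal hm
    exact ExtVanishes.middle N.injective_subtype N.mkQ_surjective
      (LinearMap.exact_subtype_mkQ N) ih (ExtVanishes.congr e.symm h)

end ExtSequences

/-! ### Injectivity of `Q / A` over one-dimensional local domains -/

section OneDimensional

open Abelian

theorem isFiniteLength_quotient_of_ne_bot {A : Type*} [CommRing A] [IsDomain A]
    [IsNoetherianRing A] [Ring.KrullDimLE 1 A] {J : Ideal A} (hJ : J ≠ ⊥) :
    IsFiniteLength A (A ⧸ J) := by
  obtain ⟨x, hx, hx0⟩ := Submodule.exists_mem_ne_zero_of_ne_bot hJ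
  exact (isFiniteLength_quotient_span_singleton A (mem_nonZeroDivisors_of_ne_zero hx0)).of_surjective
    (Submodule.factor_surjective ((Ideal.span_singleton_le_iff_mem J).2 hx))

variable {A : Type u} [CommRing A] [IsLocalRing A] [IsDomain A] [IsNoetherianRing A]
  [Ring.KrullDimLE 1 A]

/-- Supplies socle elements of `M / N`. The annihilator of the class of `v` lies in an associated
prime of its quotient; this prime contains `x ≠ 0`, so in dimension at most one it is the maximal
ideal. -/
theorem exists_smul_notMem_of_smul_mem {M : Type*} [AddCommGroup M] [Module A M]
    {N : Submodule A M} {v : M} (hv : v ∉ N) {x : A} (hx : x ≠ 0) (hxv : x • v ∈ N) :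
    ∃ y : A, y • v ∉ N ∧ ∀ a ∈ IsLocalRing.maximalIdeal A, a • y • v ∈ N := by
  let I : Ideal A := N.comap (LinearMap.toSpanSingleton A M v)
  have hI : ∀ a, a ∈ I ↔ a • v ∈ N := fun a => by simp [I]
  have hne : (Ideal.Quotient.mk I 1 : A ⧸ I) ≠ 0 := by
    rw [Ne, Ideal.Quotient.eq_zero_iff_mem, hI, one_smul]
    exact hv
  obtain ⟨P, hPass, hle⟩ := exists_le_isAssociatedPrime_of_isNoetherianRing A _ hne
  obtain ⟨hP, z, hz⟩ := isAssociatedPrime_iff.1 hPass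
  obtain ⟨y, rfl⟩ := Ideal.Quotient.mk_surjective z
  have hmem : ∀ a, a ∈ P ↔ a * y ∈ I := fun a => by
    rw [hz, Submodule.mem_colon_singleton, Submodule.mem_bot, Algebra.smul_def,
      Ideal.Quotient.algebraMap_eq, ← map_mul, Ideal.Quotient.eq_zero_iff_mem]
  have hxP : x ∈ P := (hmem x).2 (I.mul_mem_right _ ((hI x).2 hxv))
  have hPm : P = IsLocalRing.maximalIdeal A :=
    IsLocalRing.eq_maximalIdeal (hP.isMaximal_of_ne_bot fun h => hx (by simpa [h] using hxP))
  refine ⟨y, fun h => hP.ne_top ((Ideal.eq_top_iff_one P).2 ((hmem 1).2 ?_)), fun a ha => ?_⟩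
  · rwa [one_mul, hI]
  · rw [← mul_smul, ← hI, ← hmem, hPm]
    exact ha

/-- Over a one-dimensional local domain, the module `A` has no `Ext²` from the residue field as
soon as its injective dimension is finite. -/
theorem extVanishes_residueField_self (hA : ¬ IsField A) {n : ℕ}
    (h : HasInjectiveDimensionLT (ModuleCat.of A A) n) :
    ExtVanishes A (IsLocalRing.ResidueField A) A 2 := by
  -- Descending induction on the degree, which starts at degrees `≥ n`. In the step, `k` embeds into
  -- `A / xA`, whose Ext vanishes in degrees `≥ 2`, and the cokernel has finite length, so the
  -- induction hypothesis one degree higher applies to it.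
  suffices H : ∀ j i : ℕ, n ≤ i + 2 + j →
      ExtVanishes A (IsLocalRing.ResidueField A) A (i + 2) from H n 0 (by lia)
  obtain ⟨x, hx, hx0⟩ := Submodule.exists_mem_ne_zero_of_ne_bot
    (Ring.ne_bot_of_isMaximal_of_not_isField (IsLocalRing.maximalIdeal.isMaximal A) hA)
  obtain ⟨y, hy, hmy⟩ := exists_smul_notMem_of_smul_mem (N := (Ideal.span {x} : Ideal A))
    (v := (1 : A))
    (fun h1 => (IsLocalRing.maximalIdeal.isMaximal A).ne_top ((Ideal.eq_top_iff_one _).2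
      ((Ideal.span_singleton_le_iff_mem _).2 hx h1))) hx0
      (by simp)
  let φ : A →ₗ[A] A ⧸ Ideal.span {x} := (Ideal.span {x}).mkQ ∘ₗ LinearMap.toSpanSingleton A A y
  have hφ : ∀ a, φ a = 0 ↔ a • y • (1 : A) ∈ Ideal.span {x} := fun a => by
    rw [smul_smul, smul_eq_mul, mul_one]
    exact Ideal.Quotient.eq_zero_iff_mem
  have hker : LinearMap.ker φ = IsLocalRing.maximalIdeal A := by
    refine le_antisymm (IsLocalRing.le_maximalIdeal fun htop => hy ?_)
      fun a ha => (hφ a).2 (hmy a ha)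
    have : (1 : A) ∈ LinearMap.ker φ := htop ▸ Submodule.mem_top
    simpa using (hφ 1).1 this
  let ι : (A ⧸ IsLocalRing.maximalIdeal A) →ₗ[A] A ⧸ Ideal.span {x} :=
    Submodule.liftQ _ φ hker.ge
  have hι : Function.Injective ι := by
    rw [← LinearMap.ker_eq_bot, Submodule.ker_liftQ_eq_bot _ _ _ hker.le]
  have hfin := isFiniteLength_quotient_span_singleton A (mem_nonZeroDivisors_of_ne_zero hx0)
  have hx_inj : Function.Injective (LinearMap.lsmul A A x) := fun a b hab =>
    mul_left_cancel₀ hx0 (by simpa using hab)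
  have hexact : Function.Exact (LinearMap.lsmul A A x) (Ideal.span {x}).mkQ := by
    rw [LinearMap.exact_iff, Submodule.ker_mkQ]
    ext a
    simp [Ideal.mem_span_singleton, dvd_def, eq_comm]
  intro j
  induction j with
  | zero => exact fun i hi e => e.eq_zero_of_hasInjectiveDimensionLT n hi
  | succ j ih =>
    intro i hi
    have h₂ : ExtVanishes A (A ⧸ Ideal.span {x}) A (i + 2) :=
      ExtVanishes.right hx_inj (Submodule.mkQ_surjective _) hexact
        (ExtVanishes.of_projective i) (ExtVanishes.of_projective (i + 1))
    exact ExtVanishes.left hι (Submodule.mkQ_surjective (LinearMap.range ι))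
      (LinearMap.exact_map_mkQ_range ι) h₂ (ExtVanishes.of_isFiniteLength (ih (i + 1) (by lia))
        (hfin.of_surjective (Submodule.mkQ_surjective _)))

/-- The quotient `g(a) / a` does not depend on the nonzero `a ∈ I`, so `g` is multiplication by it.
-/
theorem baer_of_isFractionRing (A : Type*) [CommRing A] [IsDomain A] (Q : Type*) [Field Q]
    [Algebra A Q] [FaithfulSMul A Q] : Module.Baer A Q := by
  intro I g
  by_cases hI : I = ⊥
  · refine ⟨0, fun x hx => ?_⟩
    obtain rfl : x = 0 := by simpa [hI] using hx
    exact (map_zero g).symm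
  · obtain ⟨a, ha, ha0⟩ := Submodule.exists_mem_ne_zero_of_ne_bot hI
    have ha' : algebraMap A Q a ≠ 0 := by simpa using ha0
    refine ⟨LinearMap.toSpanSingleton A Q (g ⟨a, ha⟩ / algebraMap A Q a), fun x hx => ?_⟩
    have h : x • g ⟨a, ha⟩ = a • g ⟨x, hx⟩ := by
      rw [← map_smul, ← map_smul]
      exact congrArg g (Subtype.ext (mul_comm x a))
    rw [Algebra.smul_def, Algebra.smul_def] at h
    rw [LinearMap.toSpanSingleton_apply, Algebra.smul_def, mul_div_assoc', h,
      mul_div_cancel_left₀ _ ha']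

/-- The sequence `0 → A → Q → Q / A → 0` bounds `Ext¹(A / J, Q / A)` by `Ext²(A / J, A)`, which
vanishes since `A / J` is free or of finite length. -/
theorem baer_quotient_of_hasInjectiveDimensionLT (hA : ¬ IsField A) {n : ℕ}
    (h : HasInjectiveDimensionLT (ModuleCat.of A A) n) (Q : Type u) [Field Q] [Algebra A Q]
    [FaithfulSMul A Q] :
    Module.Baer A (Q ⧸ LinearMap.range (Algebra.linearMap A Q)) := by
  have key : ∀ J : Ideal A, ExtVanishes A (A ⧸ J) A 2 := by
    intro J
    by_cases hJ : J = ⊥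
    · exact ExtVanishes.congr (Submodule.quotEquivOfEqBot J hJ).symm (ExtVanishes.of_projective 1)
    · exact ExtVanishes.of_isFiniteLength (extVanishes_residueField_self hA h)
        (isFiniteLength_quotient_of_ne_bot hJ)
  intro J g
  have h1 : ExtVanishes A (A ⧸ J) (Q ⧸ LinearMap.range (Algebra.linearMap A Q)) 1 :=
    ExtVanishes.target_right (f := Algebra.linearMap A Q)
      (FaithfulSMul.algebraMap_injective A Q) (Submodule.mkQ_surjective _)
      (LinearMap.exact_map_mkQ_range _)
      (ExtVanishes.of_baer (baer_of_isFractionRing A Q) 0) (key J)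
  obtain ⟨ψ, hψ⟩ := ExtVanishes.exists_extension J.injective_subtype J.mkQ_surjective
    (LinearMap.exact_subtype_mkQ J) h1 g
  exact ⟨ψ, fun x hx => LinearMap.congr_fun hψ ⟨x, hx⟩⟩

/-- If `Ext²(k, W) = 0` and `x` is regular on `W`, homomorphisms from ideals to `W / xW` lift. -/
theorem exists_lift_of_extVanishes {W : Type u} [AddCommGroup W] [Module A W]
    (hW : ExtVanishes A (IsLocalRing.ResidueField A) W 2) {J : Ideal A} (hJ : J ≠ ⊥) {x : A}
    (hx : Function.Injective (LinearMap.lsmul A W x))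
    (φ : J →ₗ[A] W ⧸ LinearMap.range (LinearMap.lsmul A W x)) :
    ∃ ψ : J →ₗ[A] W, (Submodule.mkQ _) ∘ₗ ψ = φ := by
  have h1 : ExtVanishes A J W 1 :=
    ExtVanishes.left J.injective_subtype J.mkQ_surjective (LinearMap.exact_subtype_mkQ J)
      (ExtVanishes.of_projective 0)
      (ExtVanishes.of_isFiniteLength hW (isFiniteLength_quotient_of_ne_bot hJ))
  exact ExtVanishes.exists_lift hx (Submodule.mkQ_surjective _)
    (LinearMap.exact_map_mkQ_range _) h1 φ

end OneDimensional

/-! ### Extending functionals along torsion-free cokernels -/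

section TorsionFree

/-- A finitely generated torsion-free module over a domain embeds in a free module of finite
rank. -/
theorem exists_injective_pi_of_isTorsionFree (S : Type*) [CommRing S] [IsDomain S] (N : Type*)
    [AddCommGroup N] [Module S N] [Module.Finite S N] [Module.IsTorsionFree S N] :
    ∃ (n : ℕ) (i : N →ₗ[S] (Fin n → S)), Function.Injective i := by
  let L := LocalizedModule (nonZeroDivisors S) N
  let Q := FractionRing S
  have hfin : Module.Finite Q L :=
    Module.Finite.of_isLocalizedModule (nonZeroDivisors S)
      (LocalizedModule.mkLinearMap (nonZeroDivisors S) N)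
  let b := Module.finBasis Q L
  let F : N →ₗ[S] (Fin (Module.finrank Q L) → Q) :=
    (b.equivFun.toLinearMap.restrictScalars S) ∘ₗ
      LocalizedModule.mkLinearMap (nonZeroDivisors S) N
  have hF : Function.Injective F := by
    refine b.equivFun.injective.comp ((injective_iff_map_eq_zero _).2 fun x hx => ?_)
    obtain ⟨c, hc⟩ := (IsLocalizedModule.eq_zero_iff (nonZeroDivisors S) _).1 hx
    exact (smul_eq_zero_iff_right (nonZeroDivisors.ne_zero c.2)).1 hc
  obtain ⟨k, g, hg⟩ := Module.Finite.exists_fin (R := S) (M := N)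
  -- A common denominator for the coordinates of the generators: `d • F` has values in `Sⁿ`.
  obtain ⟨d, hd⟩ := IsLocalization.exist_integer_multiples_of_finite (nonZeroDivisors S)
    (fun p : Fin k × Fin (Module.finrank Q L) => F (g p.1) p.2)
  let G : Fin (Module.finrank Q L) → (N →ₗ[S] Q) := fun j =>
    (d : S) • (LinearMap.proj j ∘ₗ F)
  have hG : ∀ j x, G j x ∈ LinearMap.range (Algebra.linearMap S Q) := by
    intro j x
    have hx : x ∈ Submodule.span S (Set.range g) := hg ▸ Submodule.mem_top
    have hle : Submodule.span S (Set.range g) ≤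
        (LinearMap.range (Algebra.linearMap S Q)).comap (G j) := by
      rw [Submodule.span_le]
      rintro _ ⟨i, rfl⟩
      exact hd (i, j)
    exact hle hx
  let e : S ≃ₗ[S] LinearMap.range (Algebra.linearMap S Q) :=
    LinearEquiv.ofInjective _ (FaithfulSMul.algebraMap_injective S Q)
  refine ⟨_, LinearMap.pi fun j => e.symm.toLinearMap ∘ₗ (G j).codRestrict _ (hG j), ?_⟩
  refine (injective_iff_map_eq_zero _).2 fun x hx => ?_
  refine (injective_iff_map_eq_zero F).1 hF x (funext fun j => ?_)
  have h1 : e.symm ((G j).codRestrict _ (hG j) x) = 0 := congrFun hx j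
  rw [LinearEquiv.map_eq_zero_iff] at h1
  have h2 : (d : S) • F x j = 0 := congrArg Subtype.val h1
  exact (smul_eq_zero_iff_right (nonZeroDivisors.ne_zero d.2)).1 h2

/-- If `Q / S` is injective, then functionals extend along inclusions with finitely generated
torsion-free cokernel. -/
theorem exists_extension_of_isTorsionFree {S : Type*} [CommRing S] [IsDomain S] {Q : Type*}
    [Field Q] [Algebra S Q] [FaithfulSMul S Q]
    (hQ : Module.Baer S (Q ⧸ LinearMap.range (Algebra.linearMap S Q))) {M : Type*}
    [AddCommGroup M] [Module S M] [Module.Finite S M] (P : Submodule S M)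
    [Module.IsTorsionFree S (M ⧸ P)] (φ : P →ₗ[S] S) :
    ∃ ψ : M →ₗ[S] S, ∀ p : P, ψ p = φ p := by
  have hinj := FaithfulSMul.algebraMap_injective S Q
  let π := (LinearMap.range (Algebra.linearMap S Q)).mkQ
  -- Extend `φ` with values in `Q`. Modulo `S` the extension factors through `M / P ⊆ Sⁿ`, extends
  -- to `Sⁿ` because `Q / S` is injective, and lifts to `Q` because `Sⁿ` is free. Subtracting the
  -- lift leaves values in `S` without changing anything on `P`.
  obtain ⟨φ₁, hφ₁⟩ := (baer_of_isFractionRing S Q).extension_property P.subtype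
    P.injective_subtype (Algebra.linearMap S Q ∘ₗ φ)
  obtain ⟨n, i, hi⟩ := exists_injective_pi_of_isTorsionFree S (M ⧸ P)
  have hP : P ≤ LinearMap.ker (π ∘ₗ φ₁) := fun p hp => by
    have := LinearMap.congr_fun hφ₁ ⟨p, hp⟩
    simp only [LinearMap.comp_apply, Submodule.subtype_apply] at this
    simp [π, this]
  obtain ⟨g, hg⟩ := hQ.extension_property i hi (P.liftQ (π ∘ₗ φ₁) hP)
  obtain ⟨h, hh⟩ := Module.projective_lifting_property π g (Submodule.mkQ_surjective _)
  let φ₂ : M →ₗ[S] Q := φ₁ - h ∘ₗ i ∘ₗ P.mkQ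
  have hφ₂ : ∀ m, φ₂ m ∈ LinearMap.range (Algebra.linearMap S Q) := by
    intro m
    rw [← Submodule.Quotient.mk_eq_zero, ← Submodule.mkQ_apply]
    have h1 : π (h (i (P.mkQ m))) = π (φ₁ m) := by
      rw [← LinearMap.comp_apply π h, hh, ← LinearMap.comp_apply g i, hg]
      rfl
    change π (φ₁ m - h (i (P.mkQ m))) = 0
    rw [map_sub, h1, sub_self]
  let e : S ≃ₗ[S] LinearMap.range (Algebra.linearMap S Q) := LinearEquiv.ofInjective _ hinj
  refine ⟨e.symm.toLinearMap ∘ₗ φ₂.codRestrict _ hφ₂, fun p => ?_⟩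
  change e.symm _ = φ p
  rw [LinearEquiv.symm_apply_eq]
  refine Subtype.ext ?_
  have h1 : P.mkQ p = 0 := by simp
  have h2 : φ₁ p = algebraMap S Q (φ p) := LinearMap.congr_fun hφ₁ p
  change φ₁ (p : M) - h (i (P.mkQ (p : M))) = algebraMap S Q (φ p)
  rw [h1, h2, map_zero, map_zero, sub_zero]

end TorsionFree

/-! ### The conductor of a Gorenstein subring lies in the trace of `ω` -/

section Trace

open Abelian

variable {R : Type u} [CommRing R] [IsLocalRing R] [IsDomain R] [IsNoetherianRing R]
  [Ring.KrullDimLE 1 R] {ω : Type u} [AddCommGroup ω] [Module R ω]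

/-- A nonzero torsion element would have a nonzero multiple killed by the maximal ideal, hence a
nonzero map from the residue field to `ω`. -/
theorem isTorsionFree_of_extVanishes (h : ExtVanishes R (IsLocalRing.ResidueField R) ω 0) :
    Module.IsTorsionFree R ω := by
  rw [Module.isTorsionFree_iff_smul_eq_zero]
  intro a w haw
  by_contra! hc
  obtain ⟨y, hy, hmy⟩ := exists_smul_notMem_of_smul_mem (N := (⊥ : Submodule R ω)) (v := w)
    (by simpa using hc.2) hc.1 (by simpa using haw)
  let f : (R ⧸ IsLocalRing.maximalIdeal R) →ₗ[R] ω :=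
    Submodule.liftQ _ (LinearMap.toSpanSingleton R ω (y • w)) fun a ha => by
      simpa using hmy a ha
  have h0 := (Ext.mk₀_eq_zero_iff _).1
    (h (Ext.mk₀ (ModuleCat.ofHom (X := IsLocalRing.ResidueField R) f)))
  have h1 : f (Submodule.Quotient.mk 1) = 0 :=
    LinearMap.congr_fun (congrArg ModuleCat.Hom.hom h0) _
  have h2 : (1 : R) • y • w = 0 := h1
  exact hy (by simpa using h2)

theorem exists_comp_eq_of_ker_le {A M N P : Type*} [CommRing A] [AddCommGroup M] [Module A M]
    [AddCommGroup N] [Module A N] [AddCommGroup P] [Module A P] (p : M →ₗ[A] N) (q : M →ₗ[A] P)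
    (hp : Function.Surjective p) (h : LinearMap.ker p ≤ LinearMap.ker q) :
    ∃ φ : N →ₗ[A] P, ∀ m, φ (p m) = q m := by
  refine ⟨(LinearMap.ker p).liftQ q h ∘ₗ (p.quotKerEquivOfSurjective hp).symm.toLinearMap,
    fun m => ?_⟩
  have : (p.quotKerEquivOfSurjective hp).symm (p m) = Submodule.Quotient.mk m := by
    rw [LinearEquiv.symm_apply_eq]
    rfl
  simp [this]

/-- Reducing a module with `Ext²(k, ω) = 0` modulo a parameter gives a faithful module. -/
theorem dvd_of_smul_mem_range [Module.Finite R ω] [Module.IsTorsionFree R ω] [Nontrivial ω]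
    (h : ExtVanishes R (IsLocalRing.ResidueField R) ω 2) {x r : R} (hx : x ≠ 0)
    (hr : ∀ w : ω, r • w ∈ LinearMap.range (LinearMap.lsmul R ω x)) : x ∣ r := by
  by_contra hxr
  obtain ⟨y, hy, hmy⟩ := exists_smul_notMem_of_smul_mem (N := (Ideal.span {x} : Ideal R))
    (v := r) (by rwa [Ideal.mem_span_singleton]) hx
    (Ideal.mul_mem_right _ _ (Ideal.mem_span_singleton_self x))
  have hxm : x ∈ IsLocalRing.maximalIdeal R := fun hu => hxr hu.dvd
  have hne : ∃ v, v ∉ LinearMap.range (LinearMap.lsmul R ω x) := by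
    by_contra! hall
    have hbot := Submodule.eq_bot_of_le_smul_of_le_jacobson_bot (IsLocalRing.maximalIdeal R)
      (⊤ : Submodule R ω) Module.Finite.fg_top (fun v _ => by
        obtain ⟨w, rfl⟩ := hall v
        exact Submodule.smul_mem_smul hxm Submodule.mem_top)
      (IsLocalRing.maximalIdeal_le_jacobson _)
    exact bot_ne_top hbot.symm
  obtain ⟨v, hv⟩ := hne
  obtain ⟨z, hz, hmz⟩ := exists_smul_notMem_of_smul_mem hv hx ⟨v, rfl⟩
  -- Now `r'` and `u` are nonzero socle elements of `R / xR` and `ω / xω`. The aim is a map on the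
  -- ideal `(r', x)` with `r' ↦ u` and `x ↦ 0` modulo `xω`; its lift to `ω` is contradictory.
  set u := z • v
  set r' := y • r
  let p : (R × R) →ₗ[R] (Ideal.span {r', x} : Ideal R) :=
    ((LinearMap.toSpanSingleton R R r').coprod (LinearMap.toSpanSingleton R R x)).codRestrict _
      fun c => by
        simpa using Ideal.mem_span_pair.2 ⟨c.1, c.2, rfl⟩
  have hpv : ∀ c, (p c : R) = c.1 * r' + c.2 * x := fun c => by simp [p]
  have hp : Function.Surjective p := by
    rintro ⟨j, hj⟩
    obtain ⟨a, b, hab⟩ := Ideal.mem_span_pair.1 hj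
    exact ⟨(a, b), Subtype.ext (by rw [hpv, hab])⟩
  obtain ⟨φ, hφ⟩ := exists_comp_eq_of_ker_le p
    ((Submodule.mkQ (LinearMap.range (LinearMap.lsmul R ω x))) ∘ₗ
      (LinearMap.toSpanSingleton R ω u) ∘ₗ LinearMap.fst R R R) hp (by
    intro c hc
    have hc' : c.1 * r' + c.2 * x = 0 := by rw [← hpv, LinearMap.mem_ker.1 hc]; rfl
    have hmem : c.1 * r' ∈ Ideal.span {x} := by
      rw [eq_neg_of_add_eq_zero_left hc', Ideal.mem_span_singleton]
      exact (Dvd.intro_left _ rfl).neg_right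
    have hcm : c.1 ∈ IsLocalRing.maximalIdeal R := fun hu =>
      hy ((Ideal.unit_mul_mem_iff_mem _ hu).1 hmem)
    exact LinearMap.mem_ker.2 ((Submodule.Quotient.mk_eq_zero _).2 (hmz _ hcm)))
  have hxJ : x ∈ Ideal.span {r', x} := Ideal.subset_span (by simp)
  have hrJ : r' ∈ Ideal.span {r', x} := Ideal.subset_span (by simp)
  obtain ⟨ψ, hψ⟩ := exists_lift_of_extVanishes h (J := Ideal.span {r', x})
    (fun hbot => hx (by simpa [hbot] using hxJ)) (LinearMap.lsmul_injective hx) φ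
  have hpr : p (1, 0) = ⟨r', hrJ⟩ := Subtype.ext (by simp [hpv])
  have hpx : p (0, 1) = ⟨x, hxJ⟩ := Subtype.ext (by simp [hpv])
  have hψr : Submodule.mkQ (LinearMap.range (LinearMap.lsmul R ω x)) (ψ ⟨r', hrJ⟩) =
      Submodule.mkQ _ u := by
    rw [← LinearMap.comp_apply, hψ, ← hpr, hφ]
    simp
  have hψx : Submodule.mkQ (LinearMap.range (LinearMap.lsmul R ω x)) (ψ ⟨x, hxJ⟩) = 0 := by
    rw [← LinearMap.comp_apply, hψ, ← hpx, hφ]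
    simp
  obtain ⟨v', hv'⟩ := (Submodule.Quotient.mk_eq_zero _).1 hψx
  -- As `ψ(x) = x v'`, cancelling `x` here gives `ψ(r') = r' v'`, which lies in `xω` because `r`
  -- maps `ω` into `xω`. So `u` is zero modulo `xω`.
  have hcomm : x • ψ ⟨r', hrJ⟩ = r' • ψ ⟨x, hxJ⟩ := by
    rw [← map_smul, ← map_smul]
    exact congrArg ψ (Subtype.ext (mul_comm x r'))
  have heq : ψ ⟨r', hrJ⟩ = r' • v' := by
    refine LinearMap.lsmul_injective hx ?_
    rw [LinearMap.lsmul_apply, LinearMap.lsmul_apply, hcomm, ← hv', LinearMap.lsmul_apply,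
      smul_comm]
  have hin : ψ ⟨r', hrJ⟩ ∈ LinearMap.range (LinearMap.lsmul R ω x) := by
    rw [heq, smul_assoc]
    exact Submodule.smul_mem _ _ (hr v')
  refine hz ((Submodule.Quotient.mk_eq_zero _).1 ?_)
  rw [← Submodule.mkQ_apply, ← hψr, Submodule.mkQ_apply, Submodule.Quotient.mk_eq_zero]
  exact hin

/-- The conductor of a subring `S` with `Q / S` injective lies in the trace of every module
satisfying the homological conditions on a canonical module. -/
theorem mem_trace_of_conductor [Module.Finite R ω] [Module.IsTorsionFree R ω] [Nontrivial ω]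
    (h : ExtVanishes R (IsLocalRing.ResidueField R) ω 2) {S : Type*} [CommRing S] [IsDomain S]
    [Algebra S R] [FaithfulSMul S R] [Module.Finite S R] {Q : Type*}
    [Field Q] [Algebra S Q] [FaithfulSMul S Q]
    (hQ : Module.Baer S (Q ⧸ LinearMap.range (Algebra.linearMap S Q)))
    {s₀ : R} (hs₀ : s₀ ≠ 0) (hs₀' : ∀ r, s₀ * r ∈ (algebraMap S R).range)
    {c : R} (hc : ∀ r, c * r ∈ (algebraMap S R).range) : c ∈ trace R ω := by
  let : Module S ω := Module.compHom ω (algebraMap S R)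
  have : IsScalarTower S R ω := IsScalarTower.of_algebraMap_smul fun _ _ => rfl
  have : Module.Finite S ω := Module.Finite.trans R ω
  have hSR := FaithfulSMul.algebraMap_injective S R
  obtain ⟨n, w, hw⟩ := Module.Finite.exists_fin (R := R) (M := ω)
  have hwmem : ∀ v : ω, v ∈ Submodule.span R (Set.range w) := fun v => hw ▸ Submodule.mem_top
  have hw0 : w ≠ 0 := by
    rintro rfl
    obtain ⟨v, hv⟩ := exists_ne (0 : ω)
    refine hv ((Submodule.mem_bot R).1 (Submodule.span_le.2 ?_ (hwmem v)))
    rintro _ ⟨i, rfl⟩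
    rfl
  -- Multiplication by `c` is an `S`-linear map `R → S`. Extended along `T` to `ωⁿ → S`, it becomes
  -- an `R`-linear map `ωⁿ → R` taking the tuple of generators `w` to `c`.
  let T : R →ₗ[S] (Fin n → ω) := (LinearMap.toSpanSingleton R (Fin n → ω) w).restrictScalars S
  have hT : Function.Injective T := by
    refine (injective_iff_map_eq_zero T).2 fun r hr => ?_
    have hr : r • w = 0 := hr
    exact (smul_eq_zero.1 hr).resolve_right hw0
  -- If `r w = s m`, then `r` maps the generators, hence all of `ω`, into `sω`. Faithfulness of `ω /
  -- sω` over `R / sR` gives `r = s r'`, and cancelling `s` shows `m = r' w`.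
  have htf : Module.IsTorsionFree S ((Fin n → ω) ⧸ LinearMap.range T) := by
    rw [Module.isTorsionFree_iff_smul_eq_zero]
    intro s m hsm
    by_contra! hne
    obtain ⟨m, rfl⟩ := Submodule.Quotient.mk_surjective _ m
    rw [← Submodule.Quotient.mk_smul, Submodule.Quotient.mk_eq_zero] at hsm
    obtain ⟨r, hr⟩ := hsm
    have hr : r • w = s • m := hr
    have hs : algebraMap S R s ≠ 0 := by simpa using hne.1
    obtain ⟨r', rfl⟩ := dvd_of_smul_mem_range h hs (r := r) fun v => by
      have hle : Submodule.span R (Set.range w) ≤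
          (LinearMap.range (LinearMap.lsmul R ω (algebraMap S R s))).comap
            (LinearMap.lsmul R ω r) := by
        rw [Submodule.span_le]
        rintro _ ⟨i, rfl⟩
        refine ⟨m i, ?_⟩
        have := congrFun hr i
        simp only [Pi.smul_apply] at this
        simp [this]
      exact hle (hwmem v)
    refine hne.2 ((Submodule.Quotient.mk_eq_zero _).2 ⟨r', ?_⟩)
    have : algebraMap S R s • (r' • w) = algebraMap S R s • m := by
      rw [smul_smul, hr, algebraMap_smul]
    exact smul_right_injective _ hs this
  let e := LinearEquiv.ofInjective T hT
  let eS : S ≃ₗ[S] LinearMap.range (Algebra.linearMap S R) := LinearEquiv.ofInjective _ hSR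
  let cmul : R →ₗ[S] S := eS.symm.toLinearMap ∘ₗ
    ((LinearMap.mulLeft S c).codRestrict (LinearMap.range (Algebra.linearMap S R))
      fun r => hc r)
  have hcmul : ∀ r, algebraMap S R (cmul r) = c * r := fun r =>
    congrArg Subtype.val (eS.apply_symm_apply _)
  obtain ⟨ψ, hψ⟩ := exists_extension_of_isTorsionFree hQ (LinearMap.range T)
    (cmul ∘ₗ e.symm.toLinearMap)
  -- Both `s₀` and `s₀ r` come from `S`, so `S`-linearity gives the identity after multiplication by
  -- `s₀`.
  have hlin : ∀ (r : R) (m : Fin n → ω),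
      algebraMap S R (ψ (r • m)) = r * algebraMap S R (ψ m) := by
    intro r m
    obtain ⟨s, hs⟩ := hs₀' 1
    obtain ⟨s', hs'⟩ := hs₀' r
    refine mul_left_cancel₀ hs₀ ?_
    rw [mul_one] at hs
    have h1 : s • (r • m) = s' • m := by
      rw [← algebraMap_smul R s, ← algebraMap_smul R s', hs, hs', smul_smul]
    calc s₀ * algebraMap S R (ψ (r • m)) = algebraMap S R (ψ (s • (r • m))) := by
          rw [ψ.map_smul, smul_eq_mul, map_mul, hs]
      _ = s₀ * (r * algebraMap S R (ψ m)) := by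
          rw [h1, ψ.map_smul, smul_eq_mul, map_mul, hs', mul_assoc]
  let F : (Fin n → ω) →ₗ[R] R :=
    { toFun := fun m => algebraMap S R (ψ m)
      map_add' := fun a b => by rw [map_add, map_add]
      map_smul' := hlin }
  have hcF : c = F w := by
    have h1 := hψ (e 1)
    have h2 : ((e 1 : LinearMap.range T) : Fin n → ω) = w := one_smul R w
    rw [h2] at h1
    change c = algebraMap S R (ψ w)
    rw [h1, LinearMap.comp_apply, LinearEquiv.coe_coe, LinearEquiv.symm_apply_apply, hcmul,
      mul_one]
  rw [hcF, ← Finset.univ_sum_single w, map_sum]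
  refine Submodule.sum_mem _ fun i _ => ?_
  exact Submodule.mem_iSup_of_mem (F ∘ₗ LinearMap.single R (fun _ => ω) i) ⟨w i, rfl⟩

end Trace

/-! ### Comparison of lengths -/

section Length

variable {A M : Type*} [CommRing A] [AddCommGroup M] [Module A M]

theorem length_quotient_eq_add {X Y : Submodule A M} (h : X ≤ Y) :
    Module.length A (M ⧸ X) = Module.length A (Y ⧸ X.comap Y.subtype) +
      Module.length A (M ⧸ Y) := by
  have hf : Function.Injective (Submodule.mapQ (X.comap Y.subtype) X Y.subtype le_rfl) := by
    rw [← LinearMap.ker_eq_bot, Submodule.mapQ, Submodule.ker_liftQ_eq_bot]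
    rw [LinearMap.ker_comp, Submodule.ker_mkQ]
  refine Module.length_eq_add_of_exact _ (Submodule.factor h) hf (Submodule.factor_surjective h) ?_
  intro z
  obtain ⟨z, rfl⟩ := Submodule.Quotient.mk_surjective _ z
  rw [show Submodule.factor h (Submodule.Quotient.mk z) = Submodule.Quotient.mk z from rfl,
    Submodule.Quotient.mk_eq_zero]
  constructor
  · exact fun hz => ⟨Submodule.Quotient.mk ⟨z, hz⟩, rfl⟩
  · rintro ⟨y, hy⟩
    obtain ⟨y, rfl⟩ := Submodule.Quotient.mk_surjective _ y
    rw [Submodule.mapQ_apply, Submodule.Quotient.eq] at hy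
    simpa using Y.sub_mem y.2 (h hy)

/-- Splitting off `M / (N + P)` from both sides leaves `N / (N ∩ P)` against `(N + P) / N`. The map
`D` reverses chains of the former into chains of the latter. -/
theorem length_quotient_le_of_strictAnti {N P : Submodule A M}
    (D : Submodule A M → Submodule A M)
    (hD : ∀ J₁ J₂, N ⊓ P ≤ J₁ → J₂ ≤ N → J₁ < J₂ → D J₂ < D J₁)
    (hN : ∀ J, J ≤ N → N ≤ D J) (hP : ∀ J, N ⊓ P ≤ J → D J ≤ N ⊔ P) :
    Module.length A (M ⧸ P) ≤ Module.length A (M ⧸ N) := by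
  rw [length_quotient_eq_add (le_sup_right : P ≤ N ⊔ P),
    length_quotient_eq_add (le_sup_left : N ≤ N ⊔ P)]
  refine add_le_add_left ?_ _
  rw [← (LinearMap.quotientInfEquivSupQuotient N P).length_eq, ← WithBot.coe_le_coe,
    Module.coe_length, Module.coe_length, ← Order.krullDim_orderDual (α := Submodule A
      (↥(N ⊔ P) ⧸ Submodule.comap (N ⊔ P).subtype N))]
  let up : Submodule A (N ⧸ Submodule.comap N.subtype N ⊓ Submodule.comap N.subtype P) → Submodule A M :=
    fun J => (J.comap (Submodule.mkQ _)).map N.subtype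
  have hup : StrictMono up :=
    (Submodule.map_strictMono_of_injective N.injective_subtype).comp
      (Submodule.comap_strictMono_of_surjective (Submodule.mkQ_surjective _))
  have hup_le : ∀ J, up J ≤ N := fun J => Submodule.map_subtype_le _ _
  have hle_up : ∀ J, N ⊓ P ≤ up J := by
    intro J x hx
    refine ⟨⟨x, hx.1⟩, ?_, rfl⟩
    have : (Submodule.comap N.subtype N ⊓ Submodule.comap N.subtype P).mkQ ⟨x, hx.1⟩ = 0 :=
      (Submodule.Quotient.mk_eq_zero _).2 hx
    simp only [SetLike.mem_coe, Submodule.mem_comap, this]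
    exact J.zero_mem
  refine Order.krullDim_le_of_strictMono (fun J => OrderDual.toDual
    (((D (up J)).comap (N ⊔ P).subtype).map (Submodule.mkQ _))) fun J₁ J₂ hJ => ?_
  rw [OrderDual.toDual_lt_toDual]
  have hlt := hD _ _ (hle_up J₁) (hup_le J₂) (hup hJ)
  refine lt_of_le_of_ne (Submodule.map_mono (Submodule.comap_mono hlt.le)) fun heq => ?_
  have hcm : ∀ J, (((D (up J)).comap (N ⊔ P).subtype).map
      (Submodule.mkQ (N.comap (N ⊔ P).subtype))).comap (Submodule.mkQ _) =
      (D (up J)).comap (N ⊔ P).subtype := fun J => by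
    rw [Submodule.comap_map_eq, Submodule.ker_mkQ]
    exact sup_of_le_left (Submodule.comap_mono (hN _ (hup_le J)))
  have h1 := congrArg (Submodule.comap (Submodule.mkQ _)) heq
  rw [hcm, hcm] at h1
  have h2 := congrArg (Submodule.map (N ⊔ P).subtype) h1
  rw [Submodule.map_comap_subtype, Submodule.map_comap_subtype,
    inf_of_le_right (hP _ (hle_up _)), inf_of_le_right (hP _ (hle_up _))] at h2
  exact hlt.ne h2

theorem length_le_length_restrictScalars (S : Type*) [CommRing S] [Module S M] [Algebra S A]
    [IsScalarTower S A M] : Module.length A M ≤ Module.length S M := by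
  rw [← WithBot.coe_le_coe, Module.coe_length, Module.coe_length]
  exact Order.krullDim_le_of_strictMono _ (Submodule.restrictScalarsEmbedding S A M).strictMono

end Length

/-! ### Duality of fractional ideals and the length inequality -/

section Duality

theorem exists_smul_mem_one {S : Type*} [CommRing S] {Q : Type*} [Field Q]
    [Algebra S Q] [IsFractionRing S Q] [Nontrivial S] (y : Q) : ∃ s : S, s ≠ 0 ∧ s • y ∈ (1 : Submodule S Q) := by
  obtain ⟨⟨a, b⟩, h⟩ := IsLocalization.surj (nonZeroDivisors S) y
  exact ⟨b, nonZeroDivisors.ne_zero b.2, Submodule.mem_one.2 ⟨a, by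
    rw [Algebra.smul_def, ← h, mul_comm]⟩⟩

variable {S : Type*} [CommRing S] [IsDomain S] [IsLocalRing S] [IsNoetherianRing S]
  [Ring.KrullDimLE 1 S] {Q : Type*} [Field Q] [Algebra S Q] [IsFractionRing S Q]

/-- Duality of fractional ideals over a one-dimensional local domain with `Q / S` injective. -/
theorem one_div_one_div (hS : ¬ IsField S)
    (hQ : Module.Baer S (Q ⧸ LinearMap.range (Algebra.linearMap S Q))) {I : Submodule S Q}
    (hI : I ≠ ⊥) {s : S} (hs : s ≠ 0) (hsI : ∀ z ∈ I, s • z ∈ (1 : Submodule S Q)) :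
    1 / (1 / I) = I := by
  have hinj := FaithfulSMul.algebraMap_injective S Q
  refine le_antisymm (fun y hy => ?_) (fun z hz q hq => by rw [mul_comm]; exact hq z hz)
  by_contra hyI
  rw [← Submodule.one_eq_range] at hQ
  -- a multiple of `y` generating the socle of `Q / I`
  obtain ⟨i, hi, hi0⟩ := Submodule.exists_mem_ne_zero_of_ne_bot hI
  obtain ⟨x₁, hx₁, hx₁y⟩ : ∃ x : S, x ≠ 0 ∧ x • y ∈ I := by
    obtain ⟨b, hb, hb'⟩ := exists_smul_mem_one (S := S) (y / i)
    obtain ⟨a, ha⟩ := Submodule.mem_one.1 hb'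
    refine ⟨b, hb, ?_⟩
    have : b • y = a • i := by
      rw [Algebra.smul_def] at ha
      rw [Algebra.smul_def, Algebra.smul_def, ha, mul_assoc, div_mul_cancel₀ _ hi0]
    exact this ▸ I.smul_mem a hi
  obtain ⟨z, hz, hmz⟩ := exists_smul_notMem_of_smul_mem hyI hx₁ hx₁y
  have hyz : z • y ∈ 1 / (1 / I) := Submodule.smul_mem _ z hy
  set y' := z • y
  -- a socle element of `Q / S`
  obtain ⟨x₂, hx₂, hx₂0⟩ := Submodule.exists_mem_ne_zero_of_ne_bot
    (Ring.ne_bot_of_isMaximal_of_not_isField (IsLocalRing.maximalIdeal.isMaximal S) hS)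
  have hx₂Q : algebraMap S Q x₂ ≠ 0 := by simpa using hx₂0
  have hinv : (algebraMap S Q x₂)⁻¹ ∉ (1 : Submodule S Q) := by
    intro h
    obtain ⟨a, ha⟩ := Submodule.mem_one.1 h
    refine hx₂ (IsUnit.of_mul_eq_one a (hinj ?_))
    rw [map_mul, ha, map_one, mul_inv_cancel₀ hx₂Q]
  obtain ⟨z₂, hz₂, hmz₂⟩ := exists_smul_notMem_of_smul_mem hinv hx₂0 (by
    rw [Algebra.smul_def, mul_inv_cancel₀ hx₂Q]
    exact Submodule.one_le.1 le_rfl)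
  set v := z₂ • (algebraMap S Q x₂)⁻¹
  -- a homomorphism `Q / I → Q / S` not vanishing at `y'`
  let p : S →ₗ[S] Q ⧸ I := LinearMap.toSpanSingleton S _ (I.mkQ y')
  let q : S →ₗ[S] Q ⧸ (1 : Submodule S Q) :=
    LinearMap.toSpanSingleton S _ ((1 : Submodule S Q).mkQ v)
  have hpq : LinearMap.ker p ≤ LinearMap.ker q := by
    intro a ha
    have ha' : a • y' ∈ I := (Submodule.Quotient.mk_eq_zero _).1 ha
    refine (Submodule.Quotient.mk_eq_zero _).2 (hmz₂ a fun hu => hz ?_)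
    exact (Submodule.smul_mem_iff_of_isUnit _ hu).1 ha'
  obtain ⟨G, hG⟩ := hQ.extension_property ((LinearMap.ker p).liftQ p le_rfl)
    (LinearMap.ker_eq_bot.1 (Submodule.ker_liftQ_eq_bot' _ _ rfl))
    ((LinearMap.ker p).liftQ q hpq)
  have hGy : G (I.mkQ y') = (1 : Submodule S Q).mkQ v := by
    have : G ((1 : S) • I.mkQ y') = (1 : S) • (1 : Submodule S Q).mkQ v :=
      LinearMap.congr_fun hG (Submodule.Quotient.mk 1)
    rwa [one_smul, one_smul] at this
  -- which is multiplication by an element of `Q`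
  obtain ⟨d, hd, hdy⟩ := exists_smul_mem_one (S := S) y'
  -- Chosen so that `x` carries both `I` and `y'` into `S`. On `{t : x t ∈ S}`, which consists of
  -- the `S`-multiples of `x⁻¹`, the map `G` is determined by its value at `x⁻¹`.
  set x := s * d
  have hx : algebraMap S Q x ≠ 0 := by simpa [x] using ⟨hs, hd⟩
  obtain ⟨q', hq'⟩ := Submodule.mkQ_surjective _ (G (I.mkQ (algebraMap S Q x)⁻¹))
  have hmul : ∀ t : Q, x • t ∈ (1 : Submodule S Q) →
      G (I.mkQ t) = (1 : Submodule S Q).mkQ ((algebraMap S Q x * q') * t) := by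
    intro t ht
    obtain ⟨a, ha⟩ := Submodule.mem_one.1 ht
    rw [Algebra.smul_def] at ha
    have h1 : t = a • (algebraMap S Q x)⁻¹ := by
      rw [Algebra.smul_def, ha, mul_comm, inv_mul_cancel_left₀ hx]
    have h2 : (algebraMap S Q x * q') * t = a • q' := by
      rw [Algebra.smul_def, ha]
      ring
    rw [h2, h1, map_smul, map_smul, map_smul, hq']
  have hqI : algebraMap S Q x * q' ∈ 1 / I := by
    intro t ht
    rw [← Submodule.Quotient.mk_eq_zero, ← Submodule.mkQ_apply, ← hmul t, Submodule.mkQ_apply,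
      (Submodule.Quotient.mk_eq_zero I).2 ht, map_zero]
    change (s * d) • t ∈ _
    rw [mul_comm s d, mul_smul]
    exact Submodule.smul_mem _ _ (hsI t ht)
  refine hz₂ ((Submodule.Quotient.mk_eq_zero _).1 ?_)
  rw [← Submodule.mkQ_apply, ← hGy, hmul y' (mul_smul s d y' ▸ Submodule.smul_mem _ s hdy),
    Submodule.mkQ_apply, Submodule.Quotient.mk_eq_zero, mul_comm]
  exact hyz _ hqI

/-- Let `S ⊆ R` be birational with `Q / S` injective, and let `a = R : V` for an overring `V` of
`R`. If `a` contains the conductor of `S` in `R`, then `ℓ_S(R / a) ≤ ℓ_S(R / S)`. -/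
theorem length_quotient_colon_le (hS : ¬ IsField S)
    (hQ : Module.Baer S (Q ⧸ LinearMap.range (Algebra.linearMap S Q)))
    {R : Type*} [CommRing R] [IsDomain R] [Algebra S R] [Algebra R Q] [IsScalarTower S R Q]
    [FaithfulSMul R Q] (V : Subalgebra R Q) (a : Ideal R)
    (ha : Submodule.map (Algebra.linearMap R Q) a = 1 / Subalgebra.toSubmodule V)
    {s₀ : S} (hs₀ : s₀ ≠ 0) (hs₀' : ∀ r : R, algebraMap S R s₀ * r ∈ (algebraMap S R).range)
    (hc : ∀ c : R, (∀ r, c * r ∈ (algebraMap S R).range) → c ∈ a) :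
    Module.length S (R ⧸ a) ≤ Module.length S (R ⧸ LinearMap.range (Algebra.linearMap S R)) := by
  have hSQ := FaithfulSMul.algebraMap_injective S Q
  have hRQ := FaithfulSMul.algebraMap_injective R Q
  let ι : R →ₗ[S] Q := (Algebra.linearMap R Q).restrictScalars S
  have hι : Function.Injective ι := hRQ
  let P : Submodule S R := a.restrictScalars S
  let N : Submodule S R := LinearMap.range (Algebra.linearMap S R)
  have hN1 : N.map ι = 1 := by
    rw [Submodule.one_eq_range]
    ext q
    simp [N, ι, ← IsScalarTower.algebraMap_apply]
  have haV : ∀ q, q ∈ P.map ι ↔ ∀ v ∈ V, ∃ r : R, algebraMap R Q r = q * v := by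
    intro q
    have h1 : q ∈ P.map ι ↔ q ∈ Submodule.map (Algebra.linearMap R Q) a := Iff.rfl
    rw [h1, ha, Submodule.mem_div_iff_forall_mul_mem]
    simp only [Submodule.mem_one, Subalgebra.mem_toSubmodule]
  have hs₀a : algebraMap S R s₀ ∈ a := hc _ hs₀'
  have hs₀Q : algebraMap S Q s₀ ≠ 0 := by simpa using hs₀
  have hs₀R : ∀ r : R, s₀ • ι r ∈ (1 : Submodule S Q) := by
    intro r
    obtain ⟨t, ht⟩ := hs₀' r
    refine Submodule.mem_one.2 ⟨t, ?_⟩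
    rw [IsScalarTower.algebraMap_apply S R Q, ht, map_mul, ← IsScalarTower.algebraMap_apply,
      Algebra.smul_def]
    rfl
  have hs₀NP : algebraMap S R s₀ ∈ N ⊓ P := ⟨⟨s₀, rfl⟩, hs₀a⟩
  have hι₀ : ι (algebraMap S R s₀) ≠ 0 := by
    change algebraMap R Q _ ≠ 0
    rwa [← IsScalarTower.algebraMap_apply]
  have hbot : ∀ J : Submodule S R, N ⊓ P ≤ J → J.map ι ≠ ⊥ := fun J hJ h =>
    hι₀ ((Submodule.mem_bot S).1 (h ▸ Submodule.mem_map_of_mem (hJ hs₀NP)))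
  have hdual : ∀ J : Submodule S R, N ⊓ P ≤ J → 1 / (1 / J.map ι) = J.map ι := by
    intro J hJ
    refine one_div_one_div hS hQ (hbot J hJ) hs₀ ?_
    rintro _ ⟨r, -, rfl⟩
    exact hs₀R r
  -- `S : a ⊆ R`
  have hSaR : 1 / P.map ι ≤ (⊤ : Submodule S R).map ι := by
    rw [← hdual ⊤ le_top]
    intro y hy z hz
    have hz1 : z ∈ (1 : Submodule S Q) := by
      simpa using hz 1 ⟨1, trivial, map_one (algebraMap R Q)⟩
    obtain ⟨t, rfl⟩ := Submodule.mem_one.1 hz1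
    refine hy _ ⟨algebraMap S R t, hc _ fun r => ?_, (IsScalarTower.algebraMap_apply S R Q t).symm⟩
    obtain ⟨u, hu⟩ := Submodule.mem_one.1 (hz (ι r) ⟨r, trivial, rfl⟩)
    refine ⟨u, hRQ ?_⟩
    rw [← IsScalarTower.algebraMap_apply, hu, map_mul, ← IsScalarTower.algebraMap_apply]
    rfl
  -- `S : a ⊆ a`
  have hSaa : 1 / P.map ι ≤ P.map ι := by
    intro y hy
    rw [haV]
    intro v hv
    -- `S : a` is stable under `V` because `a = R : V` is.
    have : y * v ∈ 1 / P.map ι := by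
      intro z hz
      rw [mul_assoc]
      refine hy _ ((haV _).2 fun v' hv' => ?_)
      rw [mul_comm v z, mul_assoc]
      exact (haV z).1 hz _ (V.mul_mem hv hv')
    obtain ⟨r, -, hr⟩ := hSaR this
    exact ⟨r, hr⟩
  have hinf : (N ⊓ P).map ι = 1 ⊓ P.map ι := by rw [Submodule.map_inf _ hι, hN1]
  -- By duality `S ∩ a` contains `S : (S + (S : a))`; dualizing again, `S : (S ∩ a) ⊆ S + (S : a) ⊆
  -- S + a`.
  have hup : 1 / (N ⊓ P).map ι ≤ (N ⊔ P).map ι := by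
    have h1 : 1 / (1 ⊔ 1 / P.map ι) ≤ (N ⊓ P).map ι := by
      rw [hinf]
      intro y hy
      refine ⟨by simpa using hy 1 (Submodule.mem_sup_left (Submodule.one_le.1 le_rfl)), ?_⟩
      by_cases hNP : N ⊓ P ≤ P
      · rw [← hdual P hNP]
        exact fun z hz => hy z (Submodule.mem_sup_right hz)
      · exact absurd inf_le_right hNP
    have h2 : 1 / (1 / (1 ⊔ 1 / P.map ι)) = 1 ⊔ 1 / P.map ι := by
      refine one_div_one_div hS hQ (fun h => ?_) hs₀ fun z hz => ?_
      · have : (1 : Q) ∈ (⊥ : Submodule S Q) :=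
          h ▸ Submodule.mem_sup_left (Submodule.one_le.1 le_rfl)
        exact one_ne_zero ((Submodule.mem_bot S).1 this)
      · have hle : 1 ⊔ 1 / P.map ι ≤ (⊤ : Submodule S R).map ι :=
          sup_le (hN1 ▸ Submodule.map_mono le_top) hSaR
        obtain ⟨r, -, rfl⟩ := hle hz
        exact hs₀R r
    calc 1 / (N ⊓ P).map ι ≤ 1 / (1 / (1 ⊔ 1 / P.map ι)) := fun y hy z hz => hy z (h1 hz)
      _ = 1 ⊔ 1 / P.map ι := h2
      _ ≤ 1 ⊔ P.map ι := sup_le_sup_left hSaa _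
      _ = (N ⊔ P).map ι := by rw [Submodule.map_sup, hN1]
  refine (length_quotient_le_of_strictAnti (N := N) (P := P)
    (fun J => (1 / J.map ι).comap ι) ?_ ?_ ?_)
  · intro J₁ J₂ h₁ h₂ hlt
    have hmono : 1 / J₂.map ι ≤ 1 / J₁.map ι :=
      fun y hy z hz => hy z (Submodule.map_mono hlt.le hz)
    refine lt_of_le_of_ne (Submodule.comap_mono hmono) fun heq => hlt.ne ?_
    have hle : ∀ J : Submodule S R, N ⊓ P ≤ J → 1 / J.map ι ≤ LinearMap.range ι := by
      intro J hJ y hy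
      obtain ⟨r, -, hr⟩ := hup (fun z hz => hy z (Submodule.map_mono hJ hz))
      exact ⟨r, hr⟩
    have heq' := congrArg (Submodule.map ι) heq
    rw [Submodule.map_comap_eq_of_le (hle _ (h₁.trans hlt.le)),
      Submodule.map_comap_eq_of_le (hle _ h₁)] at heq'
    refine Submodule.map_injective_of_injective hι ?_
    rw [← hdual J₁ h₁, ← hdual J₂ (h₁.trans hlt.le), heq']
  · rintro J hJ _ ⟨s, rfl⟩ _ ⟨j, hj, rfl⟩
    obtain ⟨t, rfl⟩ := hJ hj
    refine Submodule.mem_one.2 ⟨s * t, ?_⟩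
    rw [IsScalarTower.algebraMap_apply S R Q, map_mul, map_mul]
    rfl
  · intro J hJ r hr
    obtain ⟨r', hr', h⟩ := hup (fun z hz => hr z (Submodule.map_mono hJ hz))
    exact hι h ▸ hr'

end Duality

/-! ### The Gorenstein property of local rings -/

section Transport

open Abelian

attribute [local instance] RingHomInvPair.of_ringEquiv in
theorem hasInjectiveDimensionLE_iff_of_ringEquiv {A B : Type u} [CommRing A] [CommRing B]
    (e : A ≃+* B) (n : ℕ) :
    HasInjectiveDimensionLE (ModuleCat.of A A) n ↔ HasInjectiveDimensionLE (ModuleCat.of B B) n :=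
  ModuleCat.hasInjectiveDimensionLE_iff_of_semiLinearEquiv e
    (M := ModuleCat.of A A) (N := ModuleCat.of B B)
    { e.toAddEquiv with map_smul' := fun r x => map_mul e r x } n

theorem nonempty_ringEquiv_localization_maximalIdeal (A : Type u) [CommRing A] [IsLocalRing A]
    (m : Ideal A) [m.IsMaximal] : Nonempty (A ≃+* Localization.AtPrime m) :=
  ⟨(IsLocalization.atUnits A m.primeCompl fun x hx => by
    obtain rfl := IsLocalRing.eq_maximalIdeal ‹m.IsMaximal›
    by_contra hu
    exact hx hu).toRingEquiv⟩

theorem IsGorenstein.exists_hasInjectiveDimensionLT {A : Type u} [CommRing A] [IsLocalRing A]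
    (h : IsGorenstein A) : ∃ n, HasInjectiveDimensionLT (ModuleCat.of A A) n := by
  obtain ⟨n, hn⟩ := h.finite_injectiveDimension (IsLocalRing.maximalIdeal A)
  obtain ⟨e⟩ := nonempty_ringEquiv_localization_maximalIdeal A (IsLocalRing.maximalIdeal A)
  -- `LE n` is `LT (n + 1)`, so the bound is weakened by one before it is transported.
  exact ⟨n + 1, (hasInjectiveDimensionLE_iff_of_ringEquiv e n).2
    (hasInjectiveDimensionLT_of_ge _ n (n + 1) n.le_succ)⟩

theorem isGorenstein_of_hasInjectiveDimensionLE {A : Type u} [CommRing A] [IsLocalRing A]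
    [IsNoetherianRing A] {n : ℕ} (h : HasInjectiveDimensionLE (ModuleCat.of A A) n) :
    IsGorenstein A where
  isNoetherianRing := inferInstance
  finite_injectiveDimension m _ := by
    obtain ⟨e⟩ := nonempty_ringEquiv_localization_maximalIdeal A m
    exact ⟨n + 1, (hasInjectiveDimensionLE_iff_of_ringEquiv e n).1 h⟩

end Transport

/-! ### The lower bound for `bg` -/

section LowerBound

open Abelian

variable {R : Type u} [CommRing R]

/-- A common denominator of finitely many `S`-generators of `R` works. -/
theorem exists_conductor_ne_zero {S R Q : Type*} [CommRing S] [IsDomain S] [CommRing R]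
    [Algebra S R] [Module.Finite S R] [Field Q] [Algebra S Q] [IsFractionRing S Q] [Algebra R Q]
    [FaithfulSMul R Q] [IsScalarTower S R Q] :
    ∃ s : S, s ≠ 0 ∧ ∀ r : R, algebraMap S R s * r ∈ (algebraMap S R).range := by
  obtain ⟨n, g, hg⟩ := Module.Finite.exists_fin (R := S) (M := R)
  obtain ⟨d, hd⟩ := IsLocalization.exist_integer_multiples_of_finite (nonZeroDivisors S)
    (fun i => algebraMap R Q (g i))
  refine ⟨d, nonZeroDivisors.ne_zero d.2, fun r => ?_⟩
  have hle : Submodule.span S (Set.range g) ≤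
      (LinearMap.range (Algebra.linearMap S R)).comap (LinearMap.lsmul S R (d : S)) := by
    rw [Submodule.span_le]
    rintro _ ⟨i, rfl⟩
    obtain ⟨s, hs⟩ := hd i
    refine ⟨s, FaithfulSMul.algebraMap_injective R Q ?_⟩
    rw [Algebra.linearMap_apply, ← IsScalarTower.algebraMap_apply, hs, LinearMap.lsmul_apply,
      Algebra.smul_def, Algebra.smul_def, map_mul, ← IsScalarTower.algebraMap_apply]
  have hr : r ∈ Submodule.span S (Set.range g) := hg ▸ Submodule.mem_top
  obtain ⟨s, hs⟩ := hle hr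
  exact ⟨s, by rw [← Algebra.smul_def]; exact hs⟩

/-- A nonzero prime of `S` lies under a nonzero, hence maximal, prime of `R`, and contraction along
an integral extension preserves maximality. -/
theorem krullDimLE_one_of_isIntegral (S R : Type*) [CommRing S] [IsDomain S] [CommRing R]
    [IsDomain R] [Algebra S R] [FaithfulSMul S R] [Algebra.IsIntegral S R]
    [Ring.KrullDimLE 1 R] : Ring.KrullDimLE 1 S := by
  rw [Ring.krullDimLE_one_iff_of_isPrime_bot]
  intro p hp hprime
  obtain ⟨q, hq, hqp⟩ := Ideal.exists_ideal_over_prime_of_isIntegral_of_isDomain (S := R) p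
    (by rw [(RingHom.injective_iff_ker_eq_bot _).1 (FaithfulSMul.algebraMap_injective S R)]
        exact bot_le)
  have hq0 : q ≠ ⊥ := by
    rintro rfl
    refine hp ?_
    rw [← hqp]
    exact (RingHom.injective_iff_ker_eq_bot _).1 (FaithfulSMul.algebraMap_injective S R)
  have := hq.isMaximal_of_ne_bot hq0
  rw [← hqp]
  exact Ideal.isMaximal_comap_of_isIntegral_of_isMaximal q

variable [IsLocalRing R] {ω : Type u} [AddCommGroup ω]
  [Module R ω]

theorem IsCanonicalModule.extVanishes (hω : IsCanonicalModule R ω) {i : ℕ}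
    (hi : (i : WithBot ℕ∞) ≠ ringKrullDim R) :
    ExtVanishes R (IsLocalRing.ResidueField R) ω i := by
  have := Module.length_eq_zero_iff.1 (hω.length_ext_eq_zero i hi)
  exact fun e => Subsingleton.elim _ _

theorem IsCanonicalModule.nontrivial (hω : IsCanonicalModule R ω) {i : ℕ}
    (hi : (i : WithBot ℕ∞) = ringKrullDim R) : Nontrivial ω := by
  by_contra h
  rw [not_nontrivial_iff_subsingleton] at h
  have hz : Limits.IsZero (ModuleCat.of R ω) := ModuleCat.isZero_of_subsingleton _
  have : Subsingleton (Ext (ModuleCat.of R (IsLocalRing.ResidueField R)) (ModuleCat.of R ω) i) :=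
    ⟨fun a b => by
      rw [← a.comp_mk₀_id, ← b.comp_mk₀_id, hz.eq_zero_of_tgt (𝟙 _), Ext.mk₀_zero, Ext.comp_zero,
        Ext.comp_zero]⟩
  have h1 := hω.length_ext_eq_one i hi
  rw [Module.length_eq_zero] at h1
  exact zero_ne_one h1

/-- Over a one-dimensional Noetherian local domain that is far-flung Gorenstein, the colength of
the trace of the canonical module bounds the birational Gorenstein colengths from below. -/
theorem length_quotient_trace_le [IsDomain R] [IsNoetherianRing R]
    (hdim : ringKrullDim R = 1) (hω : IsCanonicalModule R ω)
    (hR : IsFarFlungGorenstein R ω) {S : Subring R} (hS : IsGorenstein S) (hSR : IsBirational S) :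
    Module.length R (R ⧸ trace R ω) ≤
      Module.length S (R ⧸ LinearMap.range (Algebra.linearMap S R)) := by
  have : Ring.KrullDimLE 1 R := (Order.krullDimLE_iff 1 _).2 hdim.le
  have hRf : ¬ IsField R := fun h => by
    rw [ringKrullDim_eq_zero_of_isField h] at hdim
    exact zero_ne_one hdim
  have := hω.finite
  have := hω.nontrivial (i := 1) hdim.symm
  have : Module.IsTorsionFree R ω := isTorsionFree_of_extVanishes
    (hω.extVanishes (i := 0) (by rw [hdim]; exact zero_ne_one))
  have h2 : ExtVanishes R (IsLocalRing.ResidueField R) ω 2 :=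
    hω.extVanishes (by rw [hdim]; exact (by decide : ((2 : ℕ) : WithBot ℕ∞) ≠ 1))
  have := hSR.isFractionRing
  have := hSR.finite
  have := hS.isNoetherianRing
  have : FaithfulSMul S R := (faithfulSMul_iff_algebraMap_injective S R).2 Subtype.val_injective
  have : IsLocalRing S := (algebraMap S R).domain_isLocalRing
  have : Ring.KrullDimLE 1 S := krullDimLE_one_of_isIntegral S R
  have hSf : ¬ IsField S := fun h => hRf (isField_of_isIntegral_of_isField' (R := S) h)
  obtain ⟨n, hn⟩ := hS.exists_hasInjectiveDimensionLT
  have hQ := baer_quotient_of_hasInjectiveDimensionLT hSf hn (FractionRing R)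
  obtain ⟨s₀, hs₀, hs₀'⟩ := exists_conductor_ne_zero (S := S) (R := R) (Q := FractionRing R)
  refine (length_le_length_restrictScalars S).trans
    (length_quotient_colon_le hSf hQ (integralClosure R (FractionRing R)) _ hR hs₀ hs₀'
      fun c hc => mem_trace_of_conductor h2 hQ ?_ hs₀' hc)
  simpa using hs₀

end LowerBound

/-! ### `K[[H]]` is a one-dimensional Noetherian domain -/

section Basic

variable {K : Type u} [Field K] {H : AddSubmonoid ℕ}

theorem exists_conductor (hH : {a : ℕ | a ∉ H}.Finite) : ∃ c, ∀ n, c ≤ n → n ∈ H := by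
  obtain ⟨c, hc⟩ := hH.bddAbove
  refine ⟨c + 1, fun n hn => ?_⟩
  by_contra h
  exact absurd (hc h) (by lia)

theorem X_pow_mul_mem {c : ℕ} (hc : ∀ n, c ≤ n → n ∈ H) (f : PowerSeries K) :
    PowerSeries.X ^ c * f ∈ semigroupRing K H := by
  intro n hn
  rw [PowerSeries.coeff_X_pow_mul', if_neg fun h => hn (hc n h)]

theorem monomial_mem {h : ℕ} (hh : h ∈ H) (k : K) :
    PowerSeries.monomial h k ∈ semigroupRing K H := by
  intro n hn
  rw [PowerSeries.coeff_monomial, if_neg]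
  rintro rfl
  exact hn hh

/-- The ideal of the series of order at least `i` in `K[[H]]`. -/
noncomputable def orderIdeal (K : Type u) [Field K] (H : AddSubmonoid ℕ) (i : ℕ) :
    Ideal (semigroupRing K H) where
  carrier := {f | (PowerSeries.X : PowerSeries K) ^ i ∣ f}
  add_mem' := fun ha hb => by
    simpa using dvd_add ha hb
  zero_mem' := by simp
  smul_mem' := fun a b hb => by
    simpa using Dvd.dvd.mul_left hb (a : PowerSeries K)

theorem mem_orderIdeal {i : ℕ} {f : semigroupRing K H} :
    f ∈ orderIdeal K H i ↔ (PowerSeries.X : PowerSeries K) ^ i ∣ f := Iff.rfl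

theorem mem_orderIdeal_iff_coeff {i : ℕ} {f : semigroupRing K H} :
    f ∈ orderIdeal K H i ↔ ∀ n < i, PowerSeries.coeff n (f : PowerSeries K) = 0 := by
  rw [mem_orderIdeal, PowerSeries.X_pow_dvd_iff]

/-- Write `f = tᵈ u` with `u` a unit of `K[[t]]`. A series `t^(d+c) q` is `f` times `tᶜ q u⁻¹`, and
everything divisible by `tᶜ` lies in `K[[H]]`. -/
theorem exists_orderIdeal_le_span {c : ℕ} (hc : ∀ n, c ≤ n → n ∈ H) {f : semigroupRing K H}
    (hf : f ≠ 0) : ∃ N, orderIdeal K H N ≤ Ideal.span {f} := by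
  have hf' : (f : PowerSeries K) ≠ 0 := fun h => hf (Subtype.ext h)
  obtain ⟨u, hu⟩ := PowerSeries.isUnit_divided_by_X_pow_order hf'
  have hdu := (PowerSeries.X_pow_order_mul_divXPowOrder (f := (f : PowerSeries K))).symm
  rw [← hu] at hdu
  set d := (f : PowerSeries K).order.toNat
  set v : PowerSeries K := ((u⁻¹ : (PowerSeries K)ˣ) : PowerSeries K)
  have huv : (u : PowerSeries K) * v = 1 := u.mul_inv
  refine ⟨d + c, fun g hg => Ideal.mem_span_singleton.2 ?_⟩
  obtain ⟨q, hq⟩ := mem_orderIdeal.1 hg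
  refine ⟨⟨PowerSeries.X ^ c * (q * v), X_pow_mul_mem hc _⟩, Subtype.ext ?_⟩
  change (g : PowerSeries K) = (f : PowerSeries K) * (PowerSeries.X ^ c * (q * v))
  rw [hq, hdu, pow_add]
  linear_combination (-(PowerSeries.X ^ d * PowerSeries.X ^ c * q)) * huv

theorem exists_orderIdeal_le {c : ℕ} (hc : ∀ n, c ≤ n → n ∈ H) {I : Ideal (semigroupRing K H)}
    (hI : I ≠ ⊥) : ∃ N, orderIdeal K H N ≤ I := by
  obtain ⟨f, hf, hf0⟩ := Submodule.exists_mem_ne_zero_of_ne_bot hI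
  obtain ⟨N, hN⟩ := exists_orderIdeal_le_span hc hf0
  exact ⟨N, hN.trans ((Ideal.span_singleton_le_iff_mem I).2 hf)⟩

theorem finite_quotient_of_orderIdeal_le {I : Ideal (semigroupRing K H)} {N : ℕ}
    (h : orderIdeal K H N ≤ I) : Module.Finite K (semigroupRing K H ⧸ I) := by
  let T : semigroupRing K H →ₗ[K] (Fin N → K) :=
    LinearMap.pi fun i => (PowerSeries.coeff (i : ℕ)) ∘ₗ (semigroupRing K H).val.toLinearMap
  have hT : LinearMap.ker T ≤ (I.restrictScalars K : Submodule K (semigroupRing K H)) := by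
    intro f hf
    exact h (mem_orderIdeal_iff_coeff.2 fun n hn => congrFun hf ⟨n, hn⟩)
  have h1 : Module.Finite K (semigroupRing K H ⧸ LinearMap.ker T) :=
    Module.Finite.equiv T.quotKerEquivRange.symm
  exact Module.Finite.of_surjective
    (Submodule.factor hT : _ →ₗ[K] (semigroupRing K H ⧸ I.restrictScalars K))
    (Submodule.factor_surjective hT)

/-- For a nonzero `f ∈ I`, the quotient by `(f)` is finite-dimensional over `K`, so `I / (f)` is
finitely generated. -/
theorem isNoetherianRing_semigroupRing (hH : {a : ℕ | a ∉ H}.Finite) :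
    IsNoetherianRing (semigroupRing K H) := by
  obtain ⟨c, hc⟩ := exists_conductor hH
  refine isNoetherianRing_iff_ideal_fg _ |>.2 fun I => ?_
  by_cases hI : I = ⊥
  · exact hI ▸ Submodule.fg_bot
  obtain ⟨f, hf, hf0⟩ := Submodule.exists_mem_ne_zero_of_ne_bot hI
  obtain ⟨N, hN⟩ := exists_orderIdeal_le_span hc hf0
  have := finite_quotient_of_orderIdeal_le hN
  have : IsNoetherian (semigroupRing K H) (semigroupRing K H ⧸ Ideal.span {f}) :=
    isNoetherian_of_tower K inferInstance
  refine Submodule.fg_of_fg_map_of_fg_inf_ker (Submodule.mkQ (Ideal.span {f}))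
    (IsNoetherian.noetherian _) ?_
  rw [Submodule.ker_mkQ, inf_eq_right.mpr ((Ideal.span_singleton_le_iff_mem I).mpr hf)]
  exact Submodule.fg_span_singleton f

theorem mem_maximalIdeal_iff {f : semigroupRing K H} :
    f ∈ IsLocalRing.maximalIdeal (semigroupRing K H) ↔
      PowerSeries.constantCoeff (f : PowerSeries K) = 0 := by
  rw [IsLocalRing.mem_maximalIdeal, mem_nonunits_iff]
  constructor
  · intro h
    by_contra h'
    exact h (isUnit_of_constantCoeff_ne_zero f h')
  · intro h hu
    exact ((hu.map (semigroupRing K H).val).map PowerSeries.constantCoeff).ne_zero h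

theorem ringKrullDim_semigroupRing (hH : {a : ℕ | a ∉ H}.Finite) :
    ringKrullDim (semigroupRing K H) = 1 := by
  obtain ⟨c, hc⟩ := exists_conductor hH
  have hX : PowerSeries.X ^ (c + 1) * (1 : PowerSeries K) ∈ semigroupRing K H :=
    X_pow_mul_mem (fun n hn => hc n (by lia)) 1
  refine ringKrullDim_eq_one_iff_of_isLocalRing_isDomain.2 ⟨fun hF => ?_, fun x hx f hf => ?_⟩
  · have hm := (IsLocalRing.isField_iff_maximalIdeal_eq).1 hF
    have : (⟨_, hX⟩ : semigroupRing K H) ∈ IsLocalRing.maximalIdeal (semigroupRing K H) :=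
      mem_maximalIdeal_iff.2 (by simp)
    rw [hm, Submodule.mem_bot, Subtype.ext_iff] at this
    simp at this
  · obtain ⟨N, hN⟩ := exists_orderIdeal_le_span hc hx
    rw [mem_maximalIdeal_iff, ← PowerSeries.X_dvd_iff] at hf
    exact ⟨N, hN (mem_orderIdeal.2 (by simpa using pow_dvd_pow_of_dvd hf N))⟩

/-- Each fraction `x / y` over `R` equals `(s x) / (s y)`, a fraction over `S`. -/
theorem isFractionRing_of_conductor {S R Q : Type*} [CommRing S] [IsDomain S] [CommRing R]
    [IsDomain R] [Algebra S R] [FaithfulSMul S R] [Field Q] [Algebra R Q] [IsFractionRing R Q]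
    [Algebra S Q] [IsScalarTower S R Q] {s : S} (hs : s ≠ 0)
    (h : ∀ r : R, algebraMap S R s * r ∈ (algebraMap S R).range) : IsFractionRing S Q := by
  have : FaithfulSMul S Q := FaithfulSMul.trans S R Q
  have hsQ : algebraMap S Q s ≠ 0 := by simpa using hs
  refine IsFractionRing.of_field S Q fun z => ?_
  obtain ⟨x, y, hy, rfl⟩ := IsFractionRing.div_surjective (A := R) z
  obtain ⟨x', hx'⟩ := h x
  obtain ⟨y', hy'⟩ := h y
  refine ⟨x', y', ?_⟩
  rw [IsScalarTower.algebraMap_apply S R Q, IsScalarTower.algebraMap_apply S R Q, hx', hy',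
    map_mul, map_mul, ← IsScalarTower.algebraMap_apply, mul_div_mul_left _ _ hsQ]

end Basic

/-! ### The trace as an ideal of series of high order, and its colength -/

section Colength

variable {K : Type u} [Field K] {H : AddSubmonoid ℕ}

instance (H : AddSubmonoid ℕ) : FaithfulSMul (semigroupRing K H) (PowerSeries K) :=
  (faithfulSMul_iff_algebraMap_injective _ _).2 Subtype.val_injective

theorem isFractionRing_laurentSeries (hH : {a : ℕ | a ∉ H}.Finite) :
    IsFractionRing (semigroupRing K H) (LaurentSeries K) := by
  obtain ⟨c, hc⟩ := exists_conductor hH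
  refine isFractionRing_of_conductor (R := PowerSeries K)
    (s := ⟨PowerSeries.X ^ c * 1, X_pow_mul_mem hc 1⟩) (fun h => ?_) fun r => ?_
  · have := congrArg Subtype.val h
    simp at this
  · exact ⟨⟨PowerSeries.X ^ c * r, X_pow_mul_mem hc r⟩, by
      change PowerSeries.X ^ c * r = PowerSeries.X ^ c * 1 * r
      rw [mul_one]⟩

/-- Multiplication by `tᶜ` embeds `K[[t]]` as a module into the Noetherian ring `K[[H]]`, so it is
finite. -/
theorem isIntegral_powerSeries (hH : {a : ℕ | a ∉ H}.Finite) :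
    Algebra.IsIntegral (semigroupRing K H) (PowerSeries K) := by
  obtain ⟨c, hc⟩ := exists_conductor hH
  have := isNoetherianRing_semigroupRing (K := K) hH
  let T : PowerSeries K →ₗ[semigroupRing K H] semigroupRing K H :=
    { toFun := fun f => ⟨PowerSeries.X ^ c * f, X_pow_mul_mem hc f⟩
      map_add' := fun f g => Subtype.ext (mul_add _ _ _)
      map_smul' := fun r f => Subtype.ext (mul_left_comm _ _ _) }
  have : Module.Finite (semigroupRing K H) (PowerSeries K) :=
    Module.Finite.of_injective T fun f g h =>
      PowerSeries.X_pow_mul_cancel (congrArg Subtype.val h)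
  exact Algebra.IsIntegral.of_finite _ _

/-- The integral closure of `K[[H]]` in its fraction field `K((t))` is `K[[t]]`: the latter is
integral over `K[[H]]` and integrally closed. -/
theorem algebraMap_mem_conductorColon_iff (hH : {a : ℕ | a ∉ H}.Finite) (r : semigroupRing K H) :
    algebraMap (semigroupRing K H) (FractionRing (semigroupRing K H)) r ∈
      conductorColon (semigroupRing K H) ↔
    ∀ f : PowerSeries K, (r : PowerSeries K) * f ∈ semigroupRing K H := by
  have := isFractionRing_laurentSeries (K := K) hH
  have := isIntegral_powerSeries (K := K) hH
  let e := FractionRing.algEquiv (semigroupRing K H) (LaurentSeries K)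
  rw [conductorColon, Submodule.mem_div_iff_forall_mul_mem]
  constructor
  · intro h f
    have hf : e.symm (algebraMap (PowerSeries K) (LaurentSeries K) f) ∈
        integralClosure (semigroupRing K H) (FractionRing (semigroupRing K H)) := by
      refine IsIntegral.map e.symm ?_
      exact (Algebra.IsIntegral.isIntegral (R := semigroupRing K H) f).algebraMap
    obtain ⟨r', hr'⟩ := Submodule.mem_one.1 (h _ hf)
    have h1 := congrArg e hr'
    rw [map_mul, AlgEquiv.apply_symm_apply, AlgEquiv.commutes, AlgEquiv.commutes,
      IsScalarTower.algebraMap_apply (semigroupRing K H) (PowerSeries K) (LaurentSeries K),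
      IsScalarTower.algebraMap_apply (semigroupRing K H) (PowerSeries K) (LaurentSeries K),
      ← map_mul] at h1
    have h2 := FaithfulSMul.algebraMap_injective (PowerSeries K) (LaurentSeries K) h1
    exact h2 ▸ r'.2
  · intro h q hq
    have h1 : IsIntegral (semigroupRing K H) (e q) := IsIntegral.map e hq
    obtain ⟨f, hf⟩ := IsIntegrallyClosed.isIntegral_iff.1 (h1.tower_top (A := PowerSeries K))
    refine Submodule.mem_one.2 ⟨⟨_, h f⟩, e.injective ?_⟩
    rw [map_mul, AlgEquiv.commutes, AlgEquiv.commutes, ← hf,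
      IsScalarTower.algebraMap_apply (semigroupRing K H) (PowerSeries K) (LaurentSeries K),
      IsScalarTower.algebraMap_apply (semigroupRing K H) (PowerSeries K) (LaurentSeries K),
      ← map_mul]
    rfl

/-- For `n < c`, multiplication by `t^(c-1-n)` moves the coefficient at `n` to the gap `c - 1`. For
`c = 0` nothing is to be shown. -/
theorem forall_mul_mem_iff {c : ℕ} (hc : ∀ n, c ≤ n → n ∈ H) (hc' : ∀ n, n + 1 = c → n ∉ H)
    (r : semigroupRing K H) :
    (∀ f : PowerSeries K, (r : PowerSeries K) * f ∈ semigroupRing K H) ↔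
      r ∈ orderIdeal K H c := by
  constructor
  · intro h
    rw [mem_orderIdeal_iff_coeff]
    intro n hn
    have h1 := h (PowerSeries.X ^ (c - 1 - n)) (c - 1) (hc' _ (by lia))
    rwa [PowerSeries.coeff_mul_X_pow', if_pos (by lia), show c - 1 - (c - 1 - n) = n by lia] at h1
  · rintro h f
    obtain ⟨q, hq⟩ := mem_orderIdeal.1 h
    rw [hq, mul_assoc]
    exact X_pow_mul_mem hc _

theorem trace_eq_orderIdeal (hH : {a : ℕ | a ∉ H}.Finite) {c : ℕ} (hc : ∀ n, c ≤ n → n ∈ H)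
    (hc' : ∀ n, n + 1 = c → n ∉ H) {ω : Type u} [AddCommGroup ω] [Module (semigroupRing K H) ω]
    (hR : IsFarFlungGorenstein (semigroupRing K H) ω) :
    trace (semigroupRing K H) ω = orderIdeal K H c := by
  ext r
  rw [← forall_mul_mem_iff hc hc', ← algebraMap_mem_conductorColon_iff hH, ← hR]
  constructor
  · exact fun h => ⟨r, h, rfl⟩
  · rintro ⟨r', h, hr'⟩
    exact IsFractionRing.injective (semigroupRing K H) _ hr' ▸ h

theorem orderIdeal_succ_covBy {i : ℕ} (hi : i ∈ H) : orderIdeal K H (i + 1) ⋖ orderIdeal K H i := by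
  have hle : orderIdeal K H (i + 1) ≤ orderIdeal K H i := fun f hf =>
    (pow_dvd_pow _ i.le_succ).trans (mem_orderIdeal.1 hf)
  refine ⟨lt_of_le_of_ne hle fun h => ?_, fun J h₁ h₂ => ?_⟩
  · let f : semigroupRing K H := ⟨PowerSeries.monomial i 1, monomial_mem hi 1⟩
    have hf : f ∈ orderIdeal K H i := mem_orderIdeal_iff_coeff.2 fun n hn => by
      rw [PowerSeries.coeff_monomial, if_neg hn.ne]
    rw [← h, mem_orderIdeal_iff_coeff] at hf
    have := hf i i.lt_succ_self
    rw [PowerSeries.coeff_monomial, if_pos rfl] at this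
    exact one_ne_zero this
  · obtain ⟨f, hfJ, hf⟩ := SetLike.exists_of_lt h₁
    have hfi := mem_orderIdeal_iff_coeff.1 (h₂.le hfJ)
    have hcoeff : PowerSeries.coeff i (f : PowerSeries K) ≠ 0 := by
      intro h0
      refine hf (mem_orderIdeal_iff_coeff.2 fun n hn => ?_)
      rcases Nat.lt_succ_iff_lt_or_eq.1 hn with h | rfl
      · exact hfi n h
      · exact h0
    refine h₂.not_ge fun g hg => ?_
    have hgi := mem_orderIdeal_iff_coeff.1 hg
    set a := PowerSeries.coeff i (g : PowerSeries K) / PowerSeries.coeff i (f : PowerSeries K)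
    have hsub : g - a • f ∈ orderIdeal K H (i + 1) := by
      refine mem_orderIdeal_iff_coeff.2 fun n hn => ?_
      have hexp : PowerSeries.coeff n ((g - a • f : semigroupRing K H) : PowerSeries K) =
          PowerSeries.coeff n (g : PowerSeries K) -
            a * PowerSeries.coeff n (f : PowerSeries K) := by simp
      rw [hexp]
      rcases Nat.lt_succ_iff_lt_or_eq.1 hn with h | rfl
      · rw [hfi n h, hgi n h, mul_zero, sub_zero]
      · rw [div_mul_cancel₀ _ hcoeff, sub_self]
    have haf : a • f ∈ J := by
      rw [Algebra.smul_def]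
      exact J.mul_mem_left _ hfJ
    simpa using J.add_mem (h₁.le hsub) haf

theorem ncard_lt_succ_of_mem {i : ℕ} (hi : i ∈ H) :
    {n : ℕ | n ∈ H ∧ n < i + 1}.ncard = {n : ℕ | n ∈ H ∧ n < i}.ncard + 1 := by
  rw [← Set.ncard_insert_of_notMem (a := i) (fun h => lt_irrefl i h.2)
    ((Set.finite_lt_nat i).subset fun n hn => hn.2)]
  congr 1
  ext n
  constructor
  · rintro ⟨h₁, h₂⟩
    rcases Nat.lt_succ_iff_lt_or_eq.1 h₂ with h | rfl
    · exact Or.inr ⟨h₁, h⟩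
    · exact Or.inl rfl
  · rintro (rfl | h)
    · exact ⟨hi, n.lt_succ_self⟩
    · exact ⟨h.1, h.2.trans i.lt_succ_self⟩

-- The order filtration jumps, by a simple quotient, exactly at the elements of `H`.
set_option synthInstance.maxHeartbeats 200000 in
theorem length_quotient_orderIdeal (i : ℕ) :
    Module.length (semigroupRing K H) (semigroupRing K H ⧸ orderIdeal K H i) =
      ({n : ℕ | n ∈ H ∧ n < i}.ncard : ℕ∞) := by
  induction i with
  | zero =>
    have h0 : orderIdeal K H 0 = ⊤ := by
      rw [Ideal.eq_top_iff_one, mem_orderIdeal, pow_zero]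
      exact one_dvd _
    have : Subsingleton (semigroupRing K H ⧸ orderIdeal K H 0) :=
      Ideal.Quotient.subsingleton_iff.2 h0
    rw [Module.length_eq_zero]
    simp
  | succ i ih =>
    by_cases hi : i ∈ H
    · have hcov := orderIdeal_succ_covBy (K := K) hi
      have := (covBy_iff_quot_is_simple hcov.le).1 hcov
      rw [length_quotient_eq_add hcov.le, ih, Module.length_eq_one, ncard_lt_succ_of_mem hi]
      push_cast
      rw [add_comm]
    · have h1 : orderIdeal K H (i + 1) = orderIdeal K H i := by
        ext f
        rw [mem_orderIdeal_iff_coeff, mem_orderIdeal_iff_coeff]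
        refine ⟨fun h n hn => h n (by lia), fun h n hn => ?_⟩
        rcases Nat.lt_succ_iff_lt_or_eq.1 hn with h' | rfl
        · exact h n h'
        · exact f.2 _ hi
      have h2 : {n : ℕ | n ∈ H ∧ n < i + 1} = {n : ℕ | n ∈ H ∧ n < i} := by
        ext n
        refine and_congr_right fun hn => ?_
        have : n ≠ i := fun h => hi (h ▸ hn)
        lia
      rw [h1, h2, ih]

/-- Take `c = F + 1`, where counting below `c` or below `F` agrees as `F` is a gap. For `H = ℕ` take
`c = 0`, which matches the default value `sSup ∅ = 0` of `frobeniusNumber`. -/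
theorem exists_conductor_numNonGaps (hH : {a : ℕ | a ∉ H}.Finite) :
    ∃ c, (∀ n, c ≤ n → n ∈ H) ∧ (∀ n, n + 1 = c → n ∉ H) ∧
      numNonGaps H = {n : ℕ | n ∈ H ∧ n < c}.ncard := by
  rcases Set.eq_empty_or_nonempty {a : ℕ | a ∉ H} with he | hne
  · refine ⟨0, fun n _ => ?_, fun n hn => by lia, ?_⟩
    · by_contra h
      exact (he ▸ h : n ∈ (∅ : Set ℕ))
    · simp [numNonGaps, frobeniusNumber, he]
  · have hmem : frobeniusNumber H ∉ H := Nat.sSup_mem hne hH.bddAbove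
    refine ⟨frobeniusNumber H + 1, fun n hn => ?_, fun n hn => ?_, ?_⟩
    · by_contra h
      have : n ≤ frobeniusNumber H := le_csSup hH.bddAbove h
      lia
    · obtain rfl : n = frobeniusNumber H := by lia
      exact hmem
    · rw [numNonGaps]
      congr 1
      ext n
      refine and_congr_right fun h => ?_
      have : n ≠ frobeniusNumber H := fun h' => hmem (h' ▸ h)
      lia

end Colength

/-! ### Symmetric semigroups give Gorenstein rings -/

section Symmetric

variable {K : Type u} [Field K] {H : AddSubmonoid ℕ}

theorem algebraMap_laurentSeries_apply (x : semigroupRing K H) :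
    algebraMap (semigroupRing K H) (LaurentSeries K) x =
      HahnSeries.ofPowerSeries ℤ K (x : PowerSeries K) := rfl

theorem mem_range_laurentSeries_iff {z : LaurentSeries K} :
    z ∈ LinearMap.range (Algebra.linearMap (semigroupRing K H) (LaurentSeries K)) ↔
      ∀ n : ℤ, (∀ h ∈ H, (h : ℤ) ≠ n) → z.coeff n = 0 := by
  constructor
  · rintro ⟨x, rfl⟩ n hn
    rw [Algebra.linearMap_apply, algebraMap_laurentSeries_apply, PowerSeries.coeff_coe]
    split_ifs with h
    · rfl
    · refine x.2 _ fun hmem => hn _ hmem ?_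
      lia
  · intro h
    refine ⟨⟨PowerSeries.mk fun n => z.coeff n, fun n hn => ?_⟩, ?_⟩
    · rw [PowerSeries.coeff_mk]
      exact h _ fun m hm hmn => hn (by rwa [← Int.natCast_inj.1 hmn])
    · ext n
      rw [Algebra.linearMap_apply, algebraMap_laurentSeries_apply, PowerSeries.coeff_coe]
      split_ifs with hn
      · refine (h n fun m _ hm => ?_).symm
        lia
      · rw [PowerSeries.coeff_mk]
        congr 1
        lia

theorem exists_X_pow_mul_mem_range {c : ℕ} (hc : ∀ n, c ≤ n → n ∈ H) (w : LaurentSeries K) :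
    ∃ d, ∀ y : PowerSeries K, HahnSeries.ofPowerSeries ℤ K (PowerSeries.X ^ d * y) * w ∈
      LinearMap.range (Algebra.linearMap (semigroupRing K H) (LaurentSeries K)) := by
  obtain ⟨⟨v, ⟨_, k, rfl⟩⟩, hk⟩ :=
    IsLocalization.surj (Submonoid.powers (PowerSeries.X : PowerSeries K)) w
  change w * HahnSeries.ofPowerSeries ℤ K (PowerSeries.X ^ k) = HahnSeries.ofPowerSeries ℤ K v
    at hk
  refine ⟨c + k, fun y => ⟨⟨PowerSeries.X ^ c * (y * v), X_pow_mul_mem hc _⟩, ?_⟩⟩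
  rw [Algebra.linearMap_apply, algebraMap_laurentSeries_apply, map_mul, map_mul, map_mul, ← hk,
    pow_add, map_mul]
  ring

theorem coeff_ofPowerSeries_mul_sum (a : ℕ → K) (f : ℤ) (M : ℕ) (x : PowerSeries K) :
    (HahnSeries.ofPowerSeries ℤ K x *
      ∑ n ∈ Finset.range M, HahnSeries.single (f - n) (a n) : LaurentSeries K).coeff f =
      ∑ n ∈ Finset.range M, PowerSeries.coeff n x * a n := by
  rw [Finset.mul_sum, HahnSeries.coeff_sum]
  refine Finset.sum_congr rfl fun n _ => ?_
  have := HahnSeries.coeff_mul_single_add (x := HahnSeries.ofPowerSeries ℤ K x) (r := a n)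
    (a := (n : ℤ)) (b := f - n)
  rw [add_sub_cancel, LaurentSeries.coeff_coe_powerSeries] at this
  exact this

/-- The submodule `K[[H]]` of `K((t))`. -/
noncomputable abbrev laurentRange (K : Type u) [Field K] (H : AddSubmonoid ℕ) :
    Submodule (semigroupRing K H) (LaurentSeries K) :=
  LinearMap.range (Algebra.linearMap (semigroupRing K H) (LaurentSeries K))

/-- Continuity of `g`: elements of high order are multiples `s e` of one power `e` of `t` in `I`,
with `s` of such high order that it clears the denominators of a representative of `g(e)`. -/
theorem exists_orderIdeal_map_eq_zero (hH : {a : ℕ | a ∉ H}.Finite) {I : Ideal (semigroupRing K H)}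
    (hI : I ≠ ⊥) (g : I →ₗ[semigroupRing K H] LaurentSeries K ⧸ laurentRange K H) :
    ∃ M, orderIdeal K H M ≤ I ∧ ∀ i : I, (i : semigroupRing K H) ∈ orderIdeal K H M → g i = 0 := by
  obtain ⟨c, hc⟩ := exists_conductor hH
  obtain ⟨N, hN⟩ := exists_orderIdeal_le hc hI
  have he : PowerSeries.X ^ (N + c) * 1 ∈ semigroupRing K H :=
    X_pow_mul_mem (fun n hn => hc n (by lia)) _
  have heI : (⟨_, he⟩ : semigroupRing K H) ∈ I := hN (mem_orderIdeal.2 ((pow_dvd_pow _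
    (Nat.le_add_right N c)).trans (Dvd.intro _ rfl)))
  obtain ⟨w, hw⟩ := (laurentRange K H).mkQ_surjective (g ⟨_, heI⟩)
  obtain ⟨d, hd⟩ := exists_X_pow_mul_mem_range hc w
  refine ⟨N + c + (c + d), fun f hf => hN (mem_orderIdeal.2 ((pow_dvd_pow _ (by lia)).trans
    (mem_orderIdeal.1 hf))), fun i hi => ?_⟩
  obtain ⟨y, hy⟩ := mem_orderIdeal.1 hi
  have hs : PowerSeries.X ^ c * (PowerSeries.X ^ d * y) ∈ semigroupRing K H := X_pow_mul_mem hc _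
  have his : i = (⟨_, hs⟩ : semigroupRing K H) • (⟨_, heI⟩ : I) := by
    refine Subtype.ext (Subtype.ext ?_)
    rw [hy]
    change _ = PowerSeries.X ^ c * (PowerSeries.X ^ d * y) * (PowerSeries.X ^ (N + c) * 1)
    ring
  rw [his, map_smul, ← hw, ← map_smul, Submodule.mkQ_apply, Submodule.Quotient.mk_eq_zero,
    Algebra.smul_def, algebraMap_laurentSeries_apply]
  have := hd (PowerSeries.X ^ c * y)
  rwa [mul_left_comm] at this

/-- The coefficient at `f` is well defined modulo `K[[H]]` because `f` is not in `H`. -/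
theorem exists_linearMap_eq_coeff {f : ℤ} (hf : ∀ h ∈ H, (h : ℤ) ≠ f)
    {I : Ideal (semigroupRing K H)}
    (g : I →ₗ[semigroupRing K H] LaurentSeries K ⧸ laurentRange K H) :
    ∃ l : I →ₗ[K] K, ∀ (i : I) (z : LaurentSeries K), g i = (laurentRange K H).mkQ z →
      l i = z.coeff f := by
  choose lift hlift using fun i : I => (laurentRange K H).mkQ_surjective (g i)
  have hcoeff : ∀ (i : I) (z : LaurentSeries K), g i = (laurentRange K H).mkQ z →
      (lift i).coeff f = z.coeff f := by
    intro i z h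
    rw [← hlift i, ← sub_eq_zero, ← map_sub, Submodule.mkQ_apply,
      Submodule.Quotient.mk_eq_zero] at h
    rw [← sub_eq_zero, ← HahnSeries.coeff_sub]
    exact mem_range_laurentSeries_iff.1 h f hf
  refine ⟨
    { toFun := fun i => (lift i).coeff f
      map_add' := fun i j => ?_
      map_smul' := fun k i => ?_ }, hcoeff⟩
  · rw [hcoeff (i + j) (lift i + lift j) (by rw [map_add, map_add, hlift, hlift])]
    rfl
  · have hk : k • i = algebraMap K (semigroupRing K H) k • i :=
      Subtype.ext (Algebra.smul_def k (i : semigroupRing K H))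
    rw [hk, hcoeff _ (algebraMap K (semigroupRing K H) k • lift i)
      (by rw [map_smul, map_smul, hlift]), Algebra.smul_def, algebraMap_laurentSeries_apply]
    change (HahnSeries.ofPowerSeries ℤ K (PowerSeries.C k) * lift i).coeff f = _
    rw [HahnSeries.ofPowerSeries_C, HahnSeries.C_mul_eq_smul]
    rfl

/-- Functionals killing high orders are represented by the residue pairing. Extend `l` to `K[[t]]`
and let `q` have coefficient `l(tⁿ)` at `f - n` for `n < M`. -/
theorem exists_coeff_mul_eq (f : ℤ) {I : Ideal (semigroupRing K H)} {M : ℕ}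
    (hM : orderIdeal K H M ≤ I) {l : I →ₗ[K] K}
    (hl : ∀ i : I, (i : semigroupRing K H) ∈ orderIdeal K H M → l i = 0) :
    ∃ q : LaurentSeries K, ∀ i : I,
      (HahnSeries.ofPowerSeries ℤ K ((i : semigroupRing K H) : PowerSeries K) * q).coeff f =
        l i := by
  obtain ⟨l₁, hl₁⟩ := LinearMap.exists_extend (p := I.restrictScalars K) l
  obtain ⟨l₂, hl₂⟩ := LinearMap.exists_extend (p := Subalgebra.toSubmodule (semigroupRing K H)) l₁
  have hl₂' : ∀ i : I, l₂ ((i : semigroupRing K H) : PowerSeries K) = l i := fun i =>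
    (LinearMap.congr_fun hl₂ (i : semigroupRing K H)).trans (LinearMap.congr_fun hl₁ i)
  refine ⟨∑ n ∈ Finset.range M, HahnSeries.single (f - n) (l₂ (PowerSeries.X ^ n)),
    fun i => ?_⟩
  rw [coeff_ofPowerSeries_mul_sum, ← hl₂' i]
  have hx := (i : semigroupRing K H).2
  set x : PowerSeries K := ((i : semigroupRing K H) : PowerSeries K)
  have hsum : ∑ n ∈ Finset.range M, PowerSeries.coeff n x * l₂ (PowerSeries.X ^ n) =
      l₂ (∑ n ∈ Finset.range M, PowerSeries.coeff n x • PowerSeries.X ^ n) := by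
    simp only [map_sum, map_smul, smul_eq_mul]
  rw [hsum, ← sub_eq_zero, ← neg_sub, neg_eq_zero, ← map_sub]
  have hsub : ∀ n, PowerSeries.coeff n
      (x - ∑ n ∈ Finset.range M, PowerSeries.coeff n x • PowerSeries.X ^ n) =
        if n < M then 0 else PowerSeries.coeff n x := by
    intro n
    simp only [map_sub, map_sum, map_smul, PowerSeries.coeff_X_pow, smul_eq_mul, mul_ite,
      mul_one, mul_zero, Finset.sum_ite_eq, Finset.mem_range]
    split_ifs <;> simp
  let r : semigroupRing K H :=
    ⟨x - ∑ n ∈ Finset.range M, PowerSeries.coeff n x • PowerSeries.X ^ n, fun n hn => by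
      rw [hsub, hx n hn, ite_self]⟩
  have hr : r ∈ orderIdeal K H M := mem_orderIdeal_iff_coeff.2 fun n hn => by
    rw [hsub, if_pos hn]
  exact (hl₂' ⟨r, hM hr⟩).trans (hl _ hr)

theorem coeff_smul_monomial {h : ℕ} (hh : h ∈ H) {f n : ℤ} (hn : (h : ℤ) = f - n)
    (z : LaurentSeries K) :
    ((⟨PowerSeries.monomial h 1, monomial_mem hh 1⟩ : semigroupRing K H) • z).coeff f =
      z.coeff n := by
  rw [Algebra.smul_def, algebraMap_laurentSeries_apply]
  change (HahnSeries.ofPowerSeries ℤ K (PowerSeries.monomial h 1) * z).coeff f = _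
  rw [← PowerSeries.X_pow_eq, HahnSeries.ofPowerSeries_X_pow]
  have := HahnSeries.coeff_single_mul_add (x := z) (r := (1 : K)) (a := n) (b := (h : ℤ))
  rw [one_mul, hn, add_sub_cancel] at this
  rwa [hn]

set_option synthInstance.maxHeartbeats 200000 in
/-- If `H` is symmetric then `K((t)) / K[[H]]` is an injective `K[[H]]`-module. -/
theorem baer_laurentSeries_quotient (hH : {a : ℕ | a ∉ H}.Finite) {f : ℤ}
    (hf : ∀ h ∈ H, (h : ℤ) ≠ f)
    (hsym : ∀ n : ℤ, (∀ h ∈ H, (h : ℤ) ≠ n) → ∃ h ∈ H, (h : ℤ) = f - n) :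
    Module.Baer (semigroupRing K H) (LaurentSeries K ⧸ laurentRange K H) := by
  intro I g
  by_cases hI : I = ⊥
  · subst hI
    refine ⟨0, fun x hx => ?_⟩
    obtain rfl : x = 0 := hx
    exact (map_zero g).symm
  obtain ⟨M, hM, hgM⟩ := exists_orderIdeal_map_eq_zero hH hI g
  obtain ⟨l, hl⟩ := exists_linearMap_eq_coeff hf g
  obtain ⟨q, hq⟩ := exists_coeff_mul_eq f hM (l := l) fun i hi =>
    (hl i 0 (by rw [hgM i hi, map_zero])).trans (HahnSeries.coeff_zero)
  refine ⟨LinearMap.toSpanSingleton _ _ ((laurentRange K H).mkQ q), fun x hx => ?_⟩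
  obtain ⟨r, hr⟩ := (laurentRange K H).mkQ_surjective (g ⟨x, hx⟩)
  rw [LinearMap.toSpanSingleton_apply, ← map_smul, ← hr, ← sub_eq_zero, ← map_sub,
    Submodule.mkQ_apply, Submodule.Quotient.mk_eq_zero, mem_range_laurentSeries_iff]
  intro n hn
  obtain ⟨h, hh, hhn⟩ := hsym n hn
  -- By symmetry `f - n ∈ H` for a gap `n`, so the coefficient at `n` can be read at `f` after
  -- multiplying by `t^(f-n) ∈ K[[H]]`. There `g` and multiplication by `q` agree.
  rw [← coeff_smul_monomial hh hhn, smul_sub, HahnSeries.coeff_sub, sub_eq_zero]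
  set m : semigroupRing K H := ⟨PowerSeries.monomial h 1, monomial_mem hh 1⟩
  obtain ⟨i, hi⟩ : ∃ i : I, i = m • (⟨x, hx⟩ : I) := ⟨_, rfl⟩
  have h1 := hq i
  have h2 := hl i (m • r) (by rw [hi, map_smul, map_smul, hr])
  rw [← h2, ← h1, ← smul_assoc, hi]
  rfl

/-- `0 → K[[H]] → K((t)) → K((t)) / K[[H]] → 0` is an injective resolution. -/
theorem hasInjectiveDimensionLE_semigroupRing (hH : {a : ℕ | a ∉ H}.Finite) {f : ℤ}
    (hf : ∀ h ∈ H, (h : ℤ) ≠ f)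
    (hsym : ∀ n : ℤ, (∀ h ∈ H, (h : ℤ) ≠ n) → ∃ h ∈ H, (h : ℤ) = f - n) :
    HasInjectiveDimensionLE (ModuleCat.of (semigroupRing K H) (semigroupRing K H)) 1 := by
  have := isFractionRing_laurentSeries (K := K) hH
  have hL := (baer_of_isFractionRing (semigroupRing K H) (LaurentSeries K)).injective
  have hP := (baer_laurentSeries_quotient (K := K) hH hf hsym).injective
  have h2 : Injective (ModuleCat.of (semigroupRing K H) (LaurentSeries K)) :=
    Module.injective_object_of_injective_module _ _
  have h3 : Injective (ModuleCat.of (semigroupRing K H) (LaurentSeries K ⧸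
      laurentRange K H)) :=
    Module.injective_object_of_injective_module _ _
  exact (shortExact_of_exact
    (FaithfulSMul.algebraMap_injective (semigroupRing K H) (LaurentSeries K))
    (Submodule.mkQ_surjective _)
    (LinearMap.exact_map_mkQ_range _)).hasInjectiveDimensionLT_X₁ 1
      (injective_iff_hasInjectiveDimensionLT_one.1 h3)
      (have := injective_iff_hasInjectiveDimensionLT_one.1 h2
       hasInjectiveDimensionLT_of_ge _ 1 2 one_le_two)

end Symmetric

/-! ### Birational subrings and `bg` -/

section Birational

theorem isBirational_of_conductor {R : Type u} [CommRing R] [IsDomain R] {S : Subring R}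
    [IsNoetherianRing S] {s : R} (hs : s ≠ 0) (h : ∀ r, s * r ∈ S) : IsBirational S where
  isFractionRing := by
    have hsS : s ∈ S := by simpa using h 1
    have : FaithfulSMul S R := (faithfulSMul_iff_algebraMap_injective _ _).2 Subtype.val_injective
    exact isFractionRing_of_conductor (R := R) (s := ⟨s, hsS⟩)
      (fun h0 => hs (congrArg Subtype.val h0)) fun r => ⟨⟨_, h r⟩, rfl⟩
  finite := by
    let T : R →ₗ[S] S :=
      { toFun := fun r => ⟨s * r, h r⟩
        map_add' := fun a b => Subtype.ext (mul_add _ _ _)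
        map_smul' := fun a b => Subtype.ext (mul_left_comm _ _ _) }
    exact Module.Finite.of_injective T fun a b hab =>
      mul_left_cancel₀ hs (congrArg Subtype.val hab)

theorem bg_le {R : Type u} [CommRing R] {S : Subring R} (hS : IsGorenstein S)
    (hSR : IsBirational S) :
    bg R ≤ Module.length S (R ⧸ LinearMap.range (Algebra.linearMap S R)) :=
  sInf_le ⟨S, hS, hSR, rfl⟩

theorem length_quotient_trace_le_bg {R : Type u} [CommRing R] [IsLocalRing R] [IsDomain R]
    [IsNoetherianRing R] (hdim : ringKrullDim R = 1) {ω : Type u} [AddCommGroup ω] [Module R ω]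
    (hω : IsCanonicalModule R ω) (hR : IsFarFlungGorenstein R ω) :
    Module.length R (R ⧸ trace R ω) ≤ bg R := by
  refine le_sInf ?_
  rintro _ ⟨S, hS, hSR, rfl⟩
  exact length_quotient_trace_le hdim hω hR hS hSR

theorem length_le_length_of_strictMono {A B M N : Type*} [Ring A] [Ring B] [AddCommGroup M]
    [AddCommGroup N] [Module A M] [Module B N] {φ : Submodule A M → Submodule B N}
    (hφ : StrictMono φ) : Module.length A M ≤ Module.length B N := by
  rw [← WithBot.coe_le_coe, Module.coe_length, Module.coe_length]
  exact Order.krullDim_le_of_strictMono φ hφ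

end Birational

/-! ### `K[[H']]` as a subring of `K[[H]]` -/

section Subring

variable {K : Type u} [Field K] {H H' : AddSubmonoid ℕ}

theorem semigroupRing_mono (h : H' ≤ H) : semigroupRing K H' ≤ semigroupRing K H :=
  fun _ hf n hn => hf n fun hn' => hn (h hn')

/-- `K[[H']]` as a subring of `K[[H]]`, for `H' ≤ H`. -/
noncomputable def semigroupSubring (K : Type u) [Field K] (H H' : AddSubmonoid ℕ) :
    Subring (semigroupRing K H) :=
  (semigroupRing K H').toSubring.comap (semigroupRing K H).val.toRingHom

theorem mem_semigroupSubring {f : semigroupRing K H} :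
    f ∈ semigroupSubring K H H' ↔ (f : PowerSeries K) ∈ semigroupRing K H' := Iff.rfl

noncomputable def semigroupSubringEquiv (K : Type u) [Field K] (h : H' ≤ H) :
    semigroupSubring K H H' ≃+* semigroupRing K H' where
  toFun f := ⟨f.1.1, f.2⟩
  invFun f := ⟨⟨f.1, semigroupRing_mono h f.2⟩, f.2⟩
  left_inv _ := rfl
  right_inv _ := rfl
  map_mul' _ _ := rfl
  map_add' _ _ := rfl

theorem isNoetherianRing_semigroupSubring (h : H' ≤ H) (hH' : {a : ℕ | a ∉ H'}.Finite) :
    IsNoetherianRing (semigroupSubring K H H') :=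
  have := isNoetherianRing_semigroupRing (K := K) hH'
  isNoetherianRing_of_ringEquiv _ (semigroupSubringEquiv K h).symm

theorem isGorenstein_semigroupSubring (h : H' ≤ H) (hH' : {a : ℕ | a ∉ H'}.Finite) {f : ℤ}
    (hf : ∀ h ∈ H', (h : ℤ) ≠ f)
    (hsym : ∀ n : ℤ, (∀ h ∈ H', (h : ℤ) ≠ n) → ∃ h ∈ H', (h : ℤ) = f - n) :
    IsGorenstein (semigroupSubring K H H') := by
  have := isNoetherianRing_semigroupSubring (K := K) h hH'
  have := (semigroupSubringEquiv K h).symm.isLocalRing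
  exact isGorenstein_of_hasInjectiveDimensionLE
    ((hasInjectiveDimensionLE_iff_of_ringEquiv (semigroupSubringEquiv K h) 1).2
      (hasInjectiveDimensionLE_semigroupRing hH' hf hsym))

theorem isBirational_semigroupSubring (h : H' ≤ H) (hH' : {a : ℕ | a ∉ H'}.Finite) :
    IsBirational (semigroupSubring K H H') := by
  have := isNoetherianRing_semigroupSubring (K := K) h hH'
  obtain ⟨c, hc⟩ := exists_conductor hH'
  have hX : PowerSeries.X ^ c * (1 : PowerSeries K) ∈ semigroupRing K H :=
    X_pow_mul_mem (fun n hn => h (hc n hn)) 1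
  refine isBirational_of_conductor (s := ⟨_, hX⟩) (fun h0 => ?_) fun r => ?_
  · have := congrArg Subtype.val h0
    simp at this
  · rw [mem_semigroupSubring]
    change PowerSeries.X ^ c * 1 * (r : PowerSeries K) ∈ _
    rw [mul_assoc]
    exact X_pow_mul_mem hc _

-- The coefficients at `H \ H'` determine a series modulo `K[[H']]`. Since `K[[H']]` contains the
-- constants, they send its submodules to `K`-subspaces, with strict inclusions preserved.
set_option synthInstance.maxHeartbeats 200000 in
theorem length_quotient_semigroupSubring_le (hfin : {n : ℕ | n ∈ H ∧ n ∉ H'}.Finite) :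
    Module.length (semigroupSubring K H H') (semigroupRing K H ⧸
      LinearMap.range (Algebra.linearMap (semigroupSubring K H H') (semigroupRing K H))) ≤
      ({n : ℕ | n ∈ H ∧ n ∉ H'}.ncard : ℕ∞) := by
  have := hfin.fintype
  set P := LinearMap.range (Algebra.linearMap (semigroupSubring K H H') (semigroupRing K H))
  let T : semigroupRing K H → {n : ℕ | n ∈ H ∧ n ∉ H'} → K := fun r i =>
    PowerSeries.coeff (i : ℕ) (r : PowerSeries K)
  have hT : ∀ a b, T a = T b → P.mkQ a = P.mkQ b := by
    intro a b hab
    rw [← sub_eq_zero, ← map_sub, Submodule.mkQ_apply, Submodule.Quotient.mk_eq_zero]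
    refine ⟨⟨a - b, mem_semigroupSubring.2 fun n hn => ?_⟩, rfl⟩
    by_cases hnH : n ∈ H
    · have := congrFun hab ⟨n, hnH, hn⟩
      change PowerSeries.coeff n ((a : PowerSeries K) - (b : PowerSeries K)) = 0
      rw [map_sub, sub_eq_zero]
      exact this
    · exact (a - b).2 n hnH
  let φ : Submodule (semigroupSubring K H H') (semigroupRing K H ⧸ P) →
      Submodule K ({n : ℕ | n ∈ H ∧ n ∉ H'} → K) := fun W =>
    { carrier := {v | ∃ r, P.mkQ r ∈ W ∧ T r = v}
      zero_mem' := ⟨0, by rw [map_zero]; exact W.zero_mem, rfl⟩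
      add_mem' := by
        rintro _ _ ⟨a, ha, rfl⟩ ⟨b, hb, rfl⟩
        exact ⟨a + b, by rw [map_add]; exact W.add_mem ha hb, rfl⟩
      smul_mem' := by
        rintro k _ ⟨a, ha, rfl⟩
        let s : semigroupSubring K H H' := ⟨algebraMap K (semigroupRing K H) k,
          (semigroupRing K H').algebraMap_mem k⟩
        refine ⟨s • a, by rw [map_smul]; exact W.smul_mem s ha, funext fun i => ?_⟩
        change PowerSeries.coeff (i : ℕ) (PowerSeries.C k * (a : PowerSeries K)) = _
        rw [PowerSeries.coeff_C_mul]
        rfl }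
  have hφ : StrictMono φ := by
    intro W W' hWW'
    refine lt_of_le_not_ge ?_ fun h => hWW'.not_ge fun x hx => ?_
    · rintro _ ⟨r, hr, rfl⟩
      exact ⟨r, hWW'.le hr, rfl⟩
    · obtain ⟨r, rfl⟩ := P.mkQ_surjective x
      obtain ⟨r', hr', hrr'⟩ := h ⟨r, hx, rfl⟩
      rwa [← hT _ _ hrr']
  refine (length_le_length_of_strictMono hφ).trans_eq ?_
  rw [Module.length_eq_finrank, Module.finrank_fintype_fun_eq_card, Set.ncard_eq_toFinset_card',
    Set.toFinset_card]

end Subring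

/-! ### A symmetric subsemigroup of small colength -/

section Semigroup

variable {H : AddSubmonoid ℕ}

/-- The semigroup `{0} ∪ {F + 1, …, 2F} ∪ {2F + 2, …}`. -/
def symmetricSemigroup (F : ℕ) : AddSubmonoid ℕ where
  carrier := {n | n = 0 ∨ F + 1 ≤ n ∧ n ≠ 2 * F + 1}
  zero_mem' := Or.inl rfl
  add_mem' := by
    rintro a b (rfl | ha) (rfl | hb)
    · exact Or.inl rfl
    · exact Or.inr (by rwa [zero_add])
    · exact Or.inr (by rwa [add_zero])
    · exact Or.inr (by lia)

theorem mem_symmetricSemigroup {F n : ℕ} :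
    n ∈ symmetricSemigroup F ↔ n = 0 ∨ F + 1 ≤ n ∧ n ≠ 2 * F + 1 := Iff.rfl

/-- Every numerical semigroup `H` contains a symmetric one with at most `n(H)` elements of `H`
outside. -/
theorem exists_symmetric_le (hH : {a : ℕ | a ∉ H}.Finite) :
    ∃ H' ≤ H, {a : ℕ | a ∉ H'}.Finite ∧ {n : ℕ | n ∈ H ∧ n ∉ H'}.Finite ∧
      {n : ℕ | n ∈ H ∧ n ∉ H'}.ncard ≤ numNonGaps H ∧ ∃ f : ℤ, (∀ h ∈ H', (h : ℤ) ≠ f) ∧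
        ∀ n : ℤ, (∀ h ∈ H', (h : ℤ) ≠ n) → ∃ h ∈ H', (h : ℤ) = f - n := by
  rcases Set.eq_empty_or_nonempty {a : ℕ | a ∉ H} with he | hne
  · have hall : ∀ n, n ∈ H := fun n => by
      by_contra h
      exact (he ▸ h : n ∈ (∅ : Set ℕ))
    have hempty : {n : ℕ | n ∈ H ∧ n ∉ H} = ∅ := Set.eq_empty_of_forall_notMem fun n hn =>
      hn.2 hn.1
    -- `ℕ` is itself symmetric, with Frobenius number `-1` as an integer.
    refine ⟨H, le_rfl, hH, hempty ▸ Set.finite_empty, ?_, -1, fun h _ => by lia, fun n hn =>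
      ⟨(-1 - n).toNat, hall _, ?_⟩⟩
    · rw [hempty, Set.ncard_empty]
      exact Nat.zero_le _
    · have : n < 0 := by
        by_contra h0
        exact hn n.toNat (hall _) (by lia)
      lia
  · have hmem : frobeniusNumber H ∉ H := Nat.sSup_mem hne hH.bddAbove
    have hlt : ∀ n, frobeniusNumber H < n → n ∈ H := fun n hn => by
      by_contra h
      have : n ≤ frobeniusNumber H := le_csSup hH.bddAbove h
      lia
    have hF : frobeniusNumber H ≠ 0 := fun h => hmem (h ▸ H.zero_mem)
    set F := frobeniusNumber H with hFdef
    have hsub : {a : ℕ | a ∉ symmetricSemigroup F} ⊆ Set.Iic (2 * F + 1) := fun n hn => by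
      by_contra h
      exact hn (mem_symmetricSemigroup.2 (Or.inr (by rw [Set.mem_Iic] at h; lia)))
    refine ⟨symmetricSemigroup F, fun n hn => ?_, (Set.finite_Iic _).subset hsub,
      (Set.finite_Iic _).subset fun n hn => hsub hn.2, ?_, 2 * F + 1, fun h hh => ?_,
      fun n hn => ?_⟩
    · rcases mem_symmetricSemigroup.1 hn with rfl | h
      · exact H.zero_mem
      · exact hlt n h.1
    -- Outside `H'` lie the nonzero elements of `H` below `F`, and `2F + 1`; the latter takes the
    -- place of `0`.
    · refine Set.ncard_le_ncard_of_injOn (fun n => if n = 2 * F + 1 then 0 else n) ?_ ?_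
        ((Set.finite_lt_nat F).subset fun n hn => hn.2)
      · rintro n ⟨hn, hn'⟩
        have h1 : n ≠ F := fun h => hmem (h ▸ hn)
        rw [mem_symmetricSemigroup] at hn'
        split_ifs with h
        · exact ⟨H.zero_mem, by lia⟩
        · exact ⟨hn, by lia⟩
      · rintro n ⟨_, hn⟩ m ⟨_, hm⟩ hnm
        rw [mem_symmetricSemigroup] at hn hm
        dsimp only at hnm
        split_ifs at hnm <;> lia
    · rw [mem_symmetricSemigroup] at hh
      lia
    -- Reflection at `2F + 1` sends negative `n` above `2F + 1`, the gaps `1, …, F` to `2F, …, F +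
    -- 1`, and `2F + 1` to `0`.
    · have h1 : ∀ m : ℕ, (m : ℤ) = n → ¬(m = 0 ∨ F + 1 ≤ m ∧ m ≠ 2 * F + 1) := fun m hm h =>
        hn m h hm
      have h2 := h1 n.toNat
      refine ⟨(2 * F + 1 - n).toNat, mem_symmetricSemigroup.2 ?_, ?_⟩ <;> lia

end Semigroup

/-! ### Assembling the two bounds -/

section Main

/-- In a numerical semigroup ring, the birational Gorenstein colength is at most `n(H)`. -/
theorem bg_semigroupRing_le (K : Type u) [Field K] {H : AddSubmonoid ℕ}
    (hH : {a : ℕ | a ∉ H}.Finite) :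
    bg (semigroupRing K H) ≤ (numNonGaps H : ℕ∞) := by
  obtain ⟨H', hle, hH', hfin, hcard, f, hf, hsym⟩ := exists_symmetric_le hH
  refine le_trans ?_ (Nat.cast_le.2 hcard)
  refine le_trans ?_ (length_quotient_semigroupSubring_le (K := K) hfin)
  exact bg_le (isGorenstein_semigroupSubring hle hH' hf hsym)
      (isBirational_semigroupSubring hle hH')

set_option synthInstance.maxHeartbeats 200000 in
theorem length_quotient_trace {K : Type u} [Field K] {H : AddSubmonoid ℕ}
    (hH : {a : ℕ | a ∉ H}.Finite) {c : ℕ} (hc : ∀ n, c ≤ n → n ∈ H)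
    (hc' : ∀ n, n + 1 = c → n ∉ H) {ω : Type u} [AddCommGroup ω]
    [Module (semigroupRing K H) ω]
    (hR : IsFarFlungGorenstein (semigroupRing K H) ω) :
    Module.length (semigroupRing K H)
      (semigroupRing K H ⧸ trace (semigroupRing K H) ω) =
        ({n : ℕ | n ∈ H ∧ n < c}.ncard : ℕ∞) := by
  have h := length_quotient_orderIdeal (K := K) (H := H) c
  rw [← trace_eq_orderIdeal hH hc hc' hR] at h
  exact h

end Main

end FarFlung

theorem proposition4p3 (K : Type u) [Field K] (H : AddSubmonoid ℕ)
    (hH : {a : ℕ | a ∉ H}.Finite)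
    (ω : Type u) [AddCommGroup ω] [Module (FarFlung.semigroupRing K H) ω]
    (hω : FarFlung.IsCanonicalModule (FarFlung.semigroupRing K H) ω)
    (hR : FarFlung.IsFarFlungGorenstein (FarFlung.semigroupRing K H) ω) :
    FarFlung.bg (FarFlung.semigroupRing K H) = (FarFlung.numNonGaps H : ℕ∞) ∧
      (FarFlung.numNonGaps H : ℕ∞) =
        Module.length (FarFlung.semigroupRing K H)
          (FarFlung.semigroupRing K H ⧸ FarFlung.trace (FarFlung.semigroupRing K H) ω) := by
  obtain ⟨c, hc, hc', hn⟩ := FarFlung.exists_conductor_numNonGaps hH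
  have hlen : (FarFlung.numNonGaps H : ℕ∞) = Module.length (FarFlung.semigroupRing K H)
      (FarFlung.semigroupRing K H ⧸ FarFlung.trace (FarFlung.semigroupRing K H) ω) := by
    rw [FarFlung.length_quotient_trace hH hc hc' hR, hn]
  refine ⟨le_antisymm ?_ ?_, hlen⟩
  · exact FarFlung.bg_semigroupRing_le K hH
  · have := FarFlung.isNoetherianRing_semigroupRing (K := K) hH
    have hdim := FarFlung.ringKrullDim_semigroupRing (K := K) hH
    have h := FarFlung.length_quotient_trace_le_bg hdim hω hR
    rwa [← hlen] at h
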